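/- A drawing of a finite simple graph $G=(V,E)$ maps the vertices to distinct points of the plane and each edge to a simple continuous arc connecting the points of its two endvertices, such that no arc passes through a vertex in its interior, any two arcs cross transversely at every common interior point, and no three arcs cross at the same point. A crossing of the drawing is a common interior point of two distinct edges. The graph $G$ is $1$-gap-planar if it has a drawing in which each crossing can be assigned to one of the two edges that cross there so that every edge is assigned at most one crossing. Theorem. For every integer $n\ge 20$ there exists a simple $1$-gap-planar graph with exactly $n$ vertices and exactly $5n-10$ edges. -/

import Mathlib

namespace GapPlanar

/-- The plane `ℝ²`; only its topology is used. -/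
abbrev Plane : Type := ℝ × ℝ

/-- The curves `A` and `B` cross transversely at `p`: some local homeomorphism of the plane, defined
near `p`, carries `p` to the origin, `A` to the axis `x = 0` and `B` to the axis `y = 0`. In
particular, two curves that merely touch at `p`, or that overlap near `p`, do not satisfy this. -/
def CrossTransversely (A B : Set Plane) (p : Plane) : Prop :=
  ∃ φ : OpenPartialHomeomorph Plane Plane, p ∈ φ.source ∧ φ p = 0 ∧
    ∀ q ∈ φ.source, (q ∈ A ↔ (φ q).1 = 0) ∧ (q ∈ B ↔ (φ q).2 = 0)

/-- A drawing of a simple graph in the plane: vertices are distinct points, and edges are arcs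
(injective continuous images of `[0, 1]`) joining the points of their endvertices. No arc passes
through a vertex, any two arcs cross transversely wherever their interiors meet, and no three arcs
cross at the same point. Two edges may cross several times, and adjacent edges may cross. -/
structure Drawing {V : Type*} (G : SimpleGraph V) where
  point : V → Plane
  point_injective : Function.Injective point
  arc : G.edgeSet → unitInterval → Plane
  arc_continuous : ∀ e, Continuous (arc e)
  arc_injective : ∀ e, Function.Injective (arc e)
  arc_ends : ∀ e : G.edgeSet, s(arc e 0, arc e 1) = Sym2.map point (e : Sym2 V)
  arc_avoids : ∀ e, ∀ t ∈ Set.Ioo (0 : unitInterval) 1, ∀ v, arc e t ≠ point v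
  transverse : ∀ e f, e ≠ f → ∀ p ∈ arc e '' Set.Ioo 0 1 ∩ arc f '' Set.Ioo 0 1,
    CrossTransversely (Set.range (arc e)) (Set.range (arc f)) p
  no_triple : ∀ e f g, e ≠ f → f ≠ g → e ≠ g →
    arc e '' Set.Ioo 0 1 ∩ arc f '' Set.Ioo 0 1 ∩ arc g '' Set.Ioo 0 1 = ∅

namespace Drawing

variable {V : Type*} {G : SimpleGraph V}

/-- The interior of the arc that represents the edge `e`. -/
def inner (D : Drawing G) (e : G.edgeSet) : Set Plane :=
  D.arc e '' Set.Ioo 0 1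

/-- The crossing points of a drawing: the common interior points of two distinct edges. -/
def crossings (D : Drawing G) : Set Plane :=
  {p | ∃ e f, e ≠ f ∧ p ∈ D.inner e ∧ p ∈ D.inner f}

/-- A `k`-gap assignment maps each crossing point to one of the two edges that cross there, so that
each edge is assigned at most `k` crossing points. -/
def IsGapAssignment (D : Drawing G) (k : ℕ) (a : D.crossings → G.edgeSet) : Prop :=
  (∀ p : D.crossings, (p : Plane) ∈ D.inner (a p)) ∧
    ∀ e : G.edgeSet, {p : D.crossings | a p = e}.encard ≤ k

/-- A drawing is `k`-gap-planar if it admits a `k`-gap assignment. -/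
def IsGapPlanar (D : Drawing G) (k : ℕ) : Prop :=
  ∃ a : D.crossings → G.edgeSet, D.IsGapAssignment k a

end Drawing

/-- A simple graph is `k`-gap-planar if it has a `k`-gap-planar drawing. -/
def IsGapPlanarGraph {V : Type*} (G : SimpleGraph V) (k : ℕ) : Prop :=
  ∃ D : Drawing G, D.IsGapPlanar k

end GapPlanar

/-! Take a plane graph all of whose faces are pentagons. Euler's formula gives 3(E) = 5(V - 2) for
its numbers of vertices and edges, and the number of faces is 2(V - 2)/3. Drawing all five diagonals
in every face gives 5V - 10 edges in total. In each face the diagonals cross like a pentagram: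
diagonal j meets only diagonals j - 1 and j + 1, so assigning to each diagonal its crossing with the
next one uses every diagonal once.

A new vertex (hub) in the central cell of a pentagram can be joined to the five corners; the spoke
to a corner crosses only the diagonal that cuts off this corner, and this crossing is assigned to
the spoke. One vertex and five edges are added, so the count stays at 5n - 10.

The plane graph consists of d ≥ 3 congruent wedges around two poles, with 6 vertices, 10 edges and 4
pentagons per wedge, hence 6d + 2 vertices. At most five hubs then reach every n ≥ 20.

For the drawing, the sphere is unrolled to a strip whose boundary lines are the poles. There the
wedges are translates of one another by 24 and all edges are straight segments with integer
endpoints, so disjointness reduces to finite checks (`separated_of_ne`, `separated_shift`). The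
strip is wrapped onto the plane by polar coordinates followed by a Möbius map that keeps both poles
finite; the one point sent to infinity lies on no edge (`stroke_height`). Local inverses of the
wrapping carry transversality of segments over to the arcs (`crossTransversely_of_chart`). -/

namespace GapPlanar

/-! ### Wrapping a strip onto the plane -/

open Complex in
/-- The map `(θ, y) ↦ q / (q - 1)`, where `q = (1 - y) / (1 + y) * exp (i θ)`, from the strip
`|y| ≤ 1` to the plane. It collapses the two boundary lines of the strip to points. -/
noncomputable def stripMap (z : ℝ × ℝ) : ℂ :=
  (((1 - z.2 : ℝ) : ℂ) * exp (z.1 * I)) /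
    (((1 - z.2 : ℝ) : ℂ) * exp (z.1 * I) - ((1 + z.2 : ℝ) : ℂ))

/-- The points of the strip that `stripMap` sends to infinity. -/
def IsPole (z : ℝ × ℝ) : Prop :=
  ((1 - z.2 : ℝ) : ℂ) * Complex.exp (z.1 * Complex.I) = ((1 + z.2 : ℝ) : ℂ)

theorem continuousAt_stripMap {z : ℝ × ℝ} (hz : ¬ IsPole z) : ContinuousAt stripMap z := by
  unfold stripMap
  refine ContinuousAt.div (by fun_prop) (by fun_prop) ?_
  rwa [sub_ne_zero]

theorem isClosed_isPole : IsClosed {z : ℝ × ℝ | IsPole z} :=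
  isClosed_eq (by fun_prop) (by fun_prop)

/-- Infinity is the image of `q = 1` only: norms force height 0, and then the exponential must equal
1. -/
theorem IsPole.eq {z : ℝ × ℝ} (hz : IsPole z) (h : |z.2| ≤ 1) :
    z.2 = 0 ∧ ∃ m : ℤ, z.1 = m * (2 * Real.pi) := by
  obtain ⟨h1, h2⟩ := abs_le.1 h
  have h3 := congrArg norm hz
  rw [norm_mul, Complex.norm_exp_ofReal_mul_I, Complex.norm_real, Complex.norm_real,
    Real.norm_of_nonneg (by linarith), Real.norm_of_nonneg (by linarith)] at h3
  have h0 : z.2 = 0 := by linarith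
  refine ⟨h0, ?_⟩
  unfold IsPole at hz
  rw [h0] at hz
  simp only [sub_zero, add_zero, Complex.ofReal_one, one_mul] at hz
  obtain ⟨m, hm⟩ := Complex.exp_eq_one_iff.1 hz
  refine ⟨m, ?_⟩
  have := congrArg Complex.im hm
  simpa using this

theorem stripMap_top (x : ℝ) : stripMap (x, 1) = 0 := by simp [stripMap]

theorem stripMap_bottom (x : ℝ) : stripMap (x, -1) = 1 := by
  simp [stripMap]

theorem stripMap_periodic (x y : ℝ) (m : ℤ) :
    stripMap (x + m * (2 * Real.pi), y) = stripMap (x, y) := by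
  have : Complex.exp ((x + m * (2 * Real.pi) : ℝ) * Complex.I) = Complex.exp (x * Complex.I) := by
    rw [← Complex.exp_periodic.int_mul m (x * Complex.I)]
    congr 1
    push_cast
    ring
  simp only [stripMap, this]

/-- The Möbius map is injective, the modulus of `q` determines the height, and away from the
collapsed boundary lines the argument determines the abscissa up to a period. -/
theorem stripMap_eq {z w : ℝ × ℝ} (hz : |z.2| ≤ 1) (hw : |w.2| ≤ 1) (hz' : ¬ IsPole z)
    (hw' : ¬ IsPole w) (h : stripMap z = stripMap w) :
    z.2 = w.2 ∧ (|z.2| < 1 → ∃ m : ℤ, z.1 = w.1 + m * (2 * Real.pi)) := by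
  obtain ⟨hz1, hz2⟩ := abs_le.1 hz
  obtain ⟨hw1, hw2⟩ := abs_le.1 hw
  unfold stripMap at h
  rw [div_eq_div_iff (sub_ne_zero.2 hz') (sub_ne_zero.2 hw')] at h
  have key : ((1 - z.2 : ℝ) : ℂ) * Complex.exp (z.1 * Complex.I) * ((1 + w.2 : ℝ) : ℂ) =
      ((1 - w.2 : ℝ) : ℂ) * Complex.exp (w.1 * Complex.I) * ((1 + z.2 : ℝ) : ℂ) := by
    linear_combination -h
  have hn := congrArg norm key
  simp only [norm_mul, Complex.norm_exp_ofReal_mul_I, Complex.norm_real] at hn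
  rw [Real.norm_of_nonneg (by linarith), Real.norm_of_nonneg (by linarith),
    Real.norm_of_nonneg (by linarith), Real.norm_of_nonneg (by linarith)] at hn
  have h2 : z.2 = w.2 := by linarith
  refine ⟨h2, fun hlt => ?_⟩
  obtain ⟨hl1, hl2⟩ := abs_lt.1 hlt
  rw [← h2] at key
  have c1 : ((1 - z.2 : ℝ) : ℂ) ≠ 0 := by exact_mod_cast (by linarith : (1 - z.2 : ℝ) ≠ 0)
  have c2 : ((1 + z.2 : ℝ) : ℂ) ≠ 0 := by
    exact_mod_cast (by linarith : (0 : ℝ) < 1 + z.2).ne'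
  have hexp := mul_left_cancel₀ c1 (mul_right_cancel₀ c2 key)
  obtain ⟨m, hm⟩ := Complex.exp_eq_exp_iff_exists_int.1 hexp
  refine ⟨m, ?_⟩
  have := congrArg Complex.im hm
  simpa using this

/-- The map `q ↦ q / (q - 1)` is an involution, so applying it once more recovers `q`. -/
theorem stripMap_div {z : ℝ × ℝ} (hy : |z.2| < 1) (hz : ¬ IsPole z) :
    stripMap z ≠ 1 ∧ stripMap z / (stripMap z - 1) =
      (((1 - z.2) / (1 + z.2) : ℝ) : ℂ) * Complex.exp (z.1 * Complex.I) := by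
  obtain ⟨h1, h2⟩ := abs_lt.1 hy
  have c2 : ((1 + z.2 : ℝ) : ℂ) ≠ 0 := by
    exact_mod_cast (by linarith : (0 : ℝ) < 1 + z.2).ne'
  have hd := sub_ne_zero.2 hz
  have hsub : stripMap z - 1 = ((1 + z.2 : ℝ) : ℂ) /
      (((1 - z.2 : ℝ) : ℂ) * Complex.exp (z.1 * Complex.I) - ((1 + z.2 : ℝ) : ℂ)) := by
    unfold stripMap
    rw [div_sub_one hd]
    congr 1
    ring
  constructor
  · rw [← sub_ne_zero, hsub]
    exact div_ne_zero c2 hd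
  · rw [hsub, stripMap, div_div_div_cancel_right₀ hd, Complex.ofReal_div]
    ring

/-- Rotation by `-θ` moves the argument into the principal range, off the branch cut; this makes the
local inverse continuous. -/
theorem arg_stripMap {z : ℝ × ℝ} {θ : ℝ} (hθ : |z.1 - θ| < Real.pi) (hy : |z.2| < 1)
    (hz : ¬ IsPole z) :
    Complex.arg (stripMap z / (stripMap z - 1) * Complex.exp (-θ * Complex.I)) = z.1 - θ ∧
      stripMap z / (stripMap z - 1) * Complex.exp (-θ * Complex.I) ≠ 0 := by
  obtain ⟨h1, h2⟩ := abs_lt.1 hy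
  obtain ⟨h3, h4⟩ := abs_lt.1 hθ
  have hr : 0 < (1 - z.2) / (1 + z.2) := div_pos (by linarith) (by linarith)
  rw [(stripMap_div hy hz).2, mul_assoc, ← Complex.exp_add]
  have : (z.1 : ℂ) * Complex.I + -θ * Complex.I = ((z.1 - θ : ℝ) : ℂ) * Complex.I := by
    push_cast; ring
  rw [this]
  refine ⟨?_, mul_ne_zero (by exact_mod_cast hr.ne') (Complex.exp_ne_zero _)⟩
  rw [Complex.exp_mul_I]
  exact Complex.arg_mul_cos_add_sin_mul_I hr ⟨h3, h4.le⟩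

theorem exp_arg_rotate {q : ℂ} (hq : q ≠ 0) (θ : ℝ) :
    Complex.exp (((θ + Complex.arg (q * Complex.exp (-θ * Complex.I)) : ℝ) : ℂ) * Complex.I) =
      q / ‖q‖ := by
  have hn : (‖q‖ : ℂ) ≠ 0 := by simpa using hq
  have h := Complex.norm_mul_exp_arg_mul_I (q * Complex.exp (-θ * Complex.I))
  have h1 : ‖Complex.exp (-θ * Complex.I)‖ = 1 := by
    simpa using Complex.norm_exp_ofReal_mul_I (-θ)
  rw [norm_mul, h1, mul_one] at h
  have h2 : Complex.exp (θ * Complex.I) * Complex.exp (-θ * Complex.I) = 1 := by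
    rw [← Complex.exp_add]; simp
  rw [Complex.ofReal_add, add_mul, Complex.exp_add, eq_div_iff hn]
  linear_combination Complex.exp (θ * Complex.I) * h + q * h2

/-- The inverse of `stripMap` on the strip `|x - θ| < π`. -/
noncomputable def stripInv (θ : ℝ) (u : ℂ) : ℝ × ℝ :=
  (θ + Complex.arg (u / (u - 1) * Complex.exp (-θ * Complex.I)),
    (1 - ‖u / (u - 1)‖) / (1 + ‖u / (u - 1)‖))

theorem stripInv_num {u : ℂ} (h0 : u / (u - 1) ≠ 0) (θ : ℝ) :
    ((1 - (stripInv θ u).2 : ℝ) : ℂ) * Complex.exp ((stripInv θ u).1 * Complex.I) =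
      u / (u - 1) * (2 / (1 + ‖u / (u - 1)‖ : ℝ) : ℝ) ∧
    1 + (stripInv θ u).2 = 2 / (1 + ‖u / (u - 1)‖) := by
  unfold stripInv
  rw [exp_arg_rotate h0]
  generalize u / (u - 1) = q at *
  have hn : (‖q‖ : ℂ) ≠ 0 := by simpa using h0
  have hp : 1 + ‖q‖ ≠ 0 := by positivity
  have hp' : (1 + ‖q‖ : ℂ) ≠ 0 := by exact_mod_cast hp
  constructor
  · push_cast
    field_simp
    ring
  · field_simp
    ring

theorem not_isPole_stripInv {u : ℂ} (h1 : u ≠ 1) (h0 : u / (u - 1) ≠ 0) (θ : ℝ) :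
    ¬ IsPole (stripInv θ u) ∧ stripMap (stripInv θ u) = u := by
  obtain ⟨ha, hb⟩ := stripInv_num h0 θ
  have hu : u - 1 ≠ 0 := sub_ne_zero.2 h1
  have hp : (2 / (1 + ‖u / (u - 1)‖ : ℝ) : ℝ) ≠ 0 := by positivity
  have hp' : (((2 / (1 + ‖u / (u - 1)‖ : ℝ) : ℝ)) : ℂ) ≠ 0 := by exact_mod_cast hp
  constructor
  · unfold IsPole
    rw [ha, hb]
    intro h
    have h2 := mul_right_cancel₀ hp' (h.trans (one_mul _).symm)
    rw [div_eq_one_iff_eq hu] at h2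
    have : (1 : ℂ) = 0 := by linear_combination h2
    exact one_ne_zero this
  · unfold stripMap
    rw [ha, hb]
    generalize (((2 / (1 + ‖u / (u - 1)‖ : ℝ) : ℝ)) : ℂ) = c at *
    rw [← sub_one_mul, mul_div_mul_right _ _ hp', div_sub_one hu]
    field_simp
    ring

/-- The strip map restricts to a homeomorphism on the strip `|x - θ| < π`, without its poles. -/
noncomputable def stripChart (θ : ℝ) : OpenPartialHomeomorph (ℝ × ℝ) ℂ where
  toFun := stripMap
  invFun := stripInv θ
  source := {z | |z.1 - θ| < Real.pi ∧ |z.2| < 1 ∧ ¬ IsPole z}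
  target := {u | u ≠ 1 ∧ u / (u - 1) * Complex.exp (-θ * Complex.I) ∈ Complex.slitPlane}
  map_source' := by
    rintro z ⟨hθ, hy, hz⟩
    obtain ⟨h1, h2⟩ := arg_stripMap hθ hy hz
    refine ⟨(stripMap_div hy hz).1, Complex.mem_slitPlane_iff_arg.2 ⟨?_, h2⟩⟩
    rw [h1]
    exact (abs_lt.1 hθ).2.ne
  map_target' := by
    rintro u ⟨h1, h2⟩
    have h3 := Complex.mem_slitPlane_iff_arg.1 h2
    have h0 : u / (u - 1) ≠ 0 := left_ne_zero_of_mul h3.2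
    refine ⟨?_, ?_, (not_isPole_stripInv h1 h0 θ).1⟩
    · simp only [stripInv, add_sub_cancel_left]
      exact abs_lt.2 ⟨Complex.neg_pi_lt_arg _, lt_of_le_of_ne (Complex.arg_le_pi _) h3.1⟩
    · have hn : 0 < ‖u / (u - 1)‖ := norm_pos_iff.2 h0
      simp only [stripInv]
      rw [abs_lt, lt_div_iff₀ (by positivity), div_lt_iff₀ (by positivity)]
      constructor <;> linarith
  left_inv' := by
    rintro z ⟨hθ, hy, hz⟩
    obtain ⟨h1, -⟩ := arg_stripMap hθ hy hz
    obtain ⟨h3, h4⟩ := abs_lt.1 hy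
    have hr : 0 < (1 - z.2) / (1 + z.2) := div_pos (by linarith) (by linarith)
    have hn : ‖stripMap z / (stripMap z - 1)‖ = (1 - z.2) / (1 + z.2) := by
      rw [(stripMap_div hy hz).2, norm_mul, Complex.norm_exp_ofReal_mul_I, Complex.norm_real,
        Real.norm_of_nonneg hr.le, mul_one]
    refine Prod.ext ?_ ?_
    · simp only [stripInv, h1, add_sub_cancel]
    · have : 1 + z.2 ≠ 0 := by linarith
      simp only [stripInv, hn]
      field_simp
      ring
  right_inv' := by
    rintro u ⟨h1, h2⟩
    exact (not_isPole_stripInv h1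
      (left_ne_zero_of_mul (Complex.mem_slitPlane_iff_arg.1 h2).2) θ).2
  open_source := by
    have h1 : IsOpen {z : ℝ × ℝ | |z.1 - θ| < Real.pi} :=
      isOpen_lt (by fun_prop) continuous_const
    have h2 : IsOpen {z : ℝ × ℝ | |z.2| < 1} := isOpen_lt (by fun_prop) continuous_const
    exact h1.inter (h2.inter isClosed_isPole.isOpen_compl)
  open_target := by
    have h : ContinuousOn (fun u : ℂ => u / (u - 1) * Complex.exp (-θ * Complex.I)) {1}ᶜ := by
      refine ContinuousOn.mul (ContinuousOn.div (by fun_prop) (by fun_prop) ?_) (by fun_prop)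
      intro u hu
      exact sub_ne_zero.2 hu
    exact h.isOpen_inter_preimage isOpen_compl_singleton Complex.isOpen_slitPlane
  continuousOn_toFun z hz := (continuousAt_stripMap hz.2.2).continuousWithinAt
  continuousOn_invFun u hu := by
    have hu1 : u - 1 ≠ 0 := sub_ne_zero.2 hu.1
    have hc : ContinuousAt (fun u : ℂ => u / (u - 1)) u :=
      ContinuousAt.div (by fun_prop) (by fun_prop) hu1
    have h1 : ContinuousAt
        (fun u : ℂ => Complex.arg (u / (u - 1) * Complex.exp (-θ * Complex.I))) u :=
      (Complex.continuousAt_arg hu.2).comp (f := fun u : ℂ =>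
        u / (u - 1) * Complex.exp (-θ * Complex.I)) (hc.mul continuousAt_const)
    refine ContinuousAt.continuousWithinAt (ContinuousAt.prodMk (continuousAt_const.add h1) ?_)
    refine ContinuousAt.div (continuousAt_const.sub hc.norm) (continuousAt_const.add hc.norm) ?_
    positivity

/-! ### Transverse crossings of segments seen in a chart -/

/-- The affine coordinates with origin `p` and axes `v`, `u`. -/
noncomputable def obliqueHomeomorph (p u v : Plane) (h : u.1 * v.2 - u.2 * v.1 ≠ 0) :
    Plane ≃ₜ Plane where
  toFun q := ((u.1 * (q.2 - p.2) - u.2 * (q.1 - p.1)) / (u.1 * v.2 - u.2 * v.1),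
    ((q.1 - p.1) * v.2 - (q.2 - p.2) * v.1) / (u.1 * v.2 - u.2 * v.1))
  invFun q := (p.1 + q.2 * u.1 + q.1 * v.1, p.2 + q.2 * u.2 + q.1 * v.2)
  left_inv q := by
    generalize hD : u.1 * v.2 - u.2 * v.1 = D at h
    refine Prod.ext ?_ ?_ <;> · simp only; field_simp; rw [← hD]; ring
  right_inv q := by
    generalize hD : u.1 * v.2 - u.2 * v.1 = D at h
    refine Prod.ext ?_ ?_ <;> · simp only; field_simp; rw [← hD]; ring
  continuous_toFun := by fun_prop
  continuous_invFun := by fun_prop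

/-- Undoing the chart and passing to affine coordinates along the two independent directions
straightens both curves to the axes. -/
theorem crossTransversely_of_chart (χ : OpenPartialHomeomorph Plane Plane) {A B : Set Plane}
    {a u c v p : Plane} (hp : p ∈ χ.source) {t s : ℝ} (ht : t ∈ Set.Ioo (0 : ℝ) 1)
    (hs : s ∈ Set.Ioo (0 : ℝ) 1) (hpa : p = a + t • u) (hpc : p = c + s • v)
    (hdet : u.1 * v.2 - u.2 * v.1 ≠ 0)
    (hA : ∀ q ∈ χ.source, χ q ∈ A ↔ ∃ r ∈ Set.Icc (0 : ℝ) 1, q = a + r • u)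
    (hB : ∀ q ∈ χ.source, χ q ∈ B ↔ ∃ r ∈ Set.Icc (0 : ℝ) 1, q = c + r • v) :
    CrossTransversely A B (χ p) := by
  set Λ := obliqueHomeomorph p u v hdet with hΛ
  have hΛp : Λ p = 0 := by
    simp [hΛ, obliqueHomeomorph]
  -- In this box the parameters `t + (Λ q).2` and `s + (Λ q).1` stay between 0 and 1, so each
  -- segment agrees with its whole line.
  set U : Set Plane := Λ ⁻¹' (Set.Ioo (-s) (1 - s) ×ˢ Set.Ioo (-t) (1 - t)) with hU
  have hUo : IsOpen U := (isOpen_Ioo.prod isOpen_Ioo).preimage Λ.continuous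
  have hpU : p ∈ U := by
    simp only [hU, Set.mem_preimage, hΛp]
    exact ⟨⟨neg_lt_zero.2 hs.1, sub_pos.2 hs.2⟩, ⟨neg_lt_zero.2 ht.1, sub_pos.2 ht.2⟩⟩
  set χ' := χ.restrOpen U hUo with hχ'
  have hsrc : χ'.source = χ.source ∩ U := χ.restrOpen_source U hUo
  have key : ∀ q : Plane, Λ.symm (Λ q) = q := Λ.symm_apply_apply
  refine ⟨χ'.symm.trans Λ.toOpenPartialHomeomorph, ?_, ?_, ?_⟩
  · have : χ p ∈ χ'.target := χ'.map_source (hsrc ▸ ⟨hp, hpU⟩)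
    simpa using this
  · have : χ'.symm (χ p) = p := χ'.left_inv (hsrc ▸ ⟨hp, hpU⟩)
    simp [this, hΛp]
  · intro y hy
    have hy' : y ∈ χ'.target := by simpa using hy
    obtain ⟨q, hq, rfl⟩ : ∃ q ∈ χ'.source, χ' q = y :=
      ⟨χ'.symm y, χ'.map_target hy', χ'.right_inv hy'⟩
    have hval : (χ'.symm.trans Λ.toOpenPartialHomeomorph) (χ' q) = Λ q := by
      simp [χ'.left_inv hq]
    rw [hval]
    rw [hsrc] at hq
    obtain ⟨hq1, hq2, hq3⟩ := hq
    have hcoe : χ' q = χ q := rfl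
    rw [hcoe, hA q hq1, hB q hq1]
    constructor
    · constructor
      · rintro ⟨r, hr, rfl⟩
        simp only [hΛ, obliqueHomeomorph, Homeomorph.homeomorph_mk_coe, Equiv.coe_fn_mk, hpa]
        simp only [Prod.fst_add, Prod.snd_add, Prod.smul_fst, Prod.smul_snd, smul_eq_mul]
        rw [div_eq_zero_iff]
        left
        ring
      · intro h0
        refine ⟨t + (Λ q).2, ⟨by linarith [hq3.1], by linarith [hq3.2]⟩, ?_⟩
        conv_lhs => rw [← key q]
        refine Prod.ext ?_ ?_
        · change p.1 + (Λ q).2 * u.1 + (Λ q).1 * v.1 = _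
          rw [h0, hpa]
          simp only [Prod.fst_add, Prod.smul_fst, smul_eq_mul]
          ring
        · change p.2 + (Λ q).2 * u.2 + (Λ q).1 * v.2 = _
          rw [h0, hpa]
          simp only [Prod.snd_add, Prod.smul_snd, smul_eq_mul]
          ring
    · constructor
      · rintro ⟨r, hr, rfl⟩
        simp only [hΛ, obliqueHomeomorph, Homeomorph.homeomorph_mk_coe, Equiv.coe_fn_mk, hpc]
        simp only [Prod.fst_add, Prod.snd_add, Prod.smul_fst, Prod.smul_snd, smul_eq_mul]
        rw [div_eq_zero_iff]
        left
        ring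
      · intro h0
        refine ⟨s + (Λ q).1, ⟨by linarith [hq2.1], by linarith [hq2.2]⟩, ?_⟩
        conv_lhs => rw [← key q]
        refine Prod.ext ?_ ?_
        · change p.1 + (Λ q).2 * u.1 + (Λ q).1 * v.1 = _
          rw [h0, hpc]
          simp only [Prod.fst_add, Prod.smul_fst, smul_eq_mul]
          ring
        · change p.2 + (Λ q).2 * u.2 + (Λ q).1 * v.2 = _
          rw [h0, hpc]
          simp only [Prod.snd_add, Prod.smul_snd, smul_eq_mul]
          ring

/-! ### Systems of arcs and gap assignments -/

/-- A system of arcs in the plane that represents a simple graph with vertex type `V` and edges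
indexed by `ι`. Every crossing of two arcs is owned by one of them, and an arc owns crossings with
at most one other arc, which it meets at most once. -/
structure ArcSystem (V ι : Type*) where
  point : V → Plane
  point_injective : Function.Injective point
  fst : ι → V
  snd : ι → V
  fst_ne_snd : ∀ i, fst i ≠ snd i
  ends_injective : Function.Injective fun i => s(fst i, snd i)
  arc : ι → unitInterval → Plane
  arc_continuous : ∀ i, Continuous (arc i)
  arc_injective : ∀ i, Function.Injective (arc i)
  arc_zero : ∀ i, arc i 0 = point (fst i)
  arc_one : ∀ i, arc i 1 = point (snd i)
  arc_avoids : ∀ i, ∀ t ∈ Set.Ioo (0 : unitInterval) 1, ∀ v, arc i t ≠ point v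
  transverse : ∀ i j, i ≠ j → ∀ p ∈ arc i '' Set.Ioo 0 1 ∩ arc j '' Set.Ioo 0 1,
    CrossTransversely (Set.range (arc i)) (Set.range (arc j)) p
  no_triple : ∀ i j k, i ≠ j → j ≠ k → i ≠ k →
    arc i '' Set.Ioo 0 1 ∩ arc j '' Set.Ioo 0 1 ∩ arc k '' Set.Ioo 0 1 = ∅
  meet_once : ∀ i j, i ≠ j → (arc i '' Set.Ioo 0 1 ∩ arc j '' Set.Ioo 0 1).Subsingleton
  Owns : ι → ι → Prop
  owns : ∀ i j, i ≠ j → (arc i '' Set.Ioo 0 1 ∩ arc j '' Set.Ioo 0 1).Nonempty →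
    Owns i j ∨ Owns j i
  owns_unique : ∀ i j k, Owns i j → Owns i k → j = k

namespace ArcSystem

variable {V ι : Type*}

/-- The graph that is represented by a system of arcs. -/
def graph (S : ArcSystem V ι) : SimpleGraph V :=
  SimpleGraph.fromEdgeSet (Set.range fun i => s(S.fst i, S.snd i))

theorem edgeSet_graph (S : ArcSystem V ι) :
    S.graph.edgeSet = Set.range fun i => s(S.fst i, S.snd i) := by
  rw [graph, SimpleGraph.edgeSet_fromEdgeSet, sdiff_eq_left]
  rw [Set.disjoint_left]
  rintro _ ⟨i, rfl⟩ h
  exact S.fst_ne_snd i (by simpa using h)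

theorem ncard_edgeSet_graph (S : ArcSystem V ι) : S.graph.edgeSet.ncard = Nat.card ι := by
  rw [edgeSet_graph, ← Set.image_univ, Set.ncard_image_of_injective _ S.ends_injective,
    Set.ncard_univ]

/-- The arc index of an edge. -/
noncomputable def index (S : ArcSystem V ι) (e : S.graph.edgeSet) : ι :=
  (S.edgeSet_graph ▸ e.2 : (e : Sym2 V) ∈ Set.range fun i => s(S.fst i, S.snd i)).choose

theorem index_spec (S : ArcSystem V ι) (e : S.graph.edgeSet) :
    s(S.fst (S.index e), S.snd (S.index e)) = (e : Sym2 V) :=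
  (S.edgeSet_graph ▸ e.2 : (e : Sym2 V) ∈ Set.range fun i => s(S.fst i, S.snd i)).choose_spec

theorem index_injective (S : ArcSystem V ι) : Function.Injective S.index := by
  intro e f h
  apply Subtype.ext
  rw [← S.index_spec e, ← S.index_spec f, h]

/-- The drawing that is given by a system of arcs. -/
noncomputable def drawing (S : ArcSystem V ι) : Drawing S.graph where
  point := S.point
  point_injective := S.point_injective
  arc e := S.arc (S.index e)
  arc_continuous e := S.arc_continuous _
  arc_injective e := S.arc_injective _
  arc_ends e := by
    rw [S.arc_zero, S.arc_one, ← S.index_spec e, Sym2.map_mk]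
  arc_avoids e := S.arc_avoids _
  transverse e f h := S.transverse _ _ (S.index_injective.ne h)
  no_triple e f g h₁ h₂ h₃ := S.no_triple _ _ _ (S.index_injective.ne h₁)
    (S.index_injective.ne h₂) (S.index_injective.ne h₃)

/-- Each crossing goes to an owner. Two crossings assigned to the same arc involve the same second
arc by `owns_unique`, hence coincide by `meet_once`. -/
theorem isGapPlanarGraph (S : ArcSystem V ι) : IsGapPlanarGraph S.graph 1 := by
  refine ⟨S.drawing, ?_⟩
  have h : ∀ p : S.drawing.crossings, ∃ e f, e ≠ f ∧ (p : Plane) ∈ S.drawing.inner e ∧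
      (p : Plane) ∈ S.drawing.inner f ∧ S.Owns (S.index e) (S.index f) := by
    rintro ⟨p, e, f, hne, he, hf⟩
    rcases S.owns _ _ (S.index_injective.ne hne) ⟨p, he, hf⟩ with h | h
    · exact ⟨e, f, hne, he, hf, h⟩
    · exact ⟨f, e, hne.symm, hf, he, h⟩
  choose a b hne ha hb hown using h
  refine ⟨a, ha, fun e => ?_⟩
  rw [Nat.cast_one, Set.encard_le_one_iff]
  rintro p q rfl hq
  have hq' : a q = a p := hq
  have hbq : S.index (b q) = S.index (b p) :=
    S.owns_unique _ _ _ (hq' ▸ hown q) (hown p)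
  apply Subtype.ext
  refine S.meet_once _ _ (S.index_injective.ne (hne p)) ⟨ha p, hb p⟩ ⟨hq' ▸ ha q, ?_⟩
  rw [← S.index_injective hbq]
  exact hb q

/-- A subsystem of a system of arcs, with relabelled vertices. -/
noncomputable def restrict {V' ι' : Type*} (S : ArcSystem V ι) (f : V' → V)
    (hf : Function.Injective f) (g : ι' → ι) (hg : Function.Injective g)
    (h₁ : ∀ i, ∃ v, f v = S.fst (g i)) (h₂ : ∀ i, ∃ v, f v = S.snd (g i)) :
    ArcSystem V' ι' where
  point v := S.point (f v)
  point_injective := S.point_injective.comp hf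
  fst i := (h₁ i).choose
  snd i := (h₂ i).choose
  fst_ne_snd i h := S.fst_ne_snd (g i) (by
    rw [← (h₁ i).choose_spec, ← (h₂ i).choose_spec, h])
  ends_injective i j h := by
    apply hg
    apply S.ends_injective
    have := congrArg (Sym2.map f) h
    simpa only [Sym2.map_mk, (h₁ _).choose_spec, (h₂ _).choose_spec] using this
  arc i := S.arc (g i)
  arc_continuous i := S.arc_continuous _
  arc_injective i := S.arc_injective _
  arc_zero i := by rw [S.arc_zero, (h₁ i).choose_spec]
  arc_one i := by rw [S.arc_one, (h₂ i).choose_spec]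
  arc_avoids i t ht v := S.arc_avoids _ t ht _
  transverse i j h := S.transverse _ _ (hg.ne h)
  no_triple i j k h₁ h₂ h₃ := S.no_triple _ _ _ (hg.ne h₁) (hg.ne h₂) (hg.ne h₃)
  meet_once i j h := S.meet_once _ _ (hg.ne h)
  Owns i j := S.Owns (g i) (g j)
  owns i j h := S.owns _ _ (hg.ne h)
  owns_unique i j k h₁ h₂ := hg (S.owns_unique _ _ _ h₁ h₂)

end ArcSystem

/-! ### The wrapping map in the scale of the drawing -/

/-- The map from the strip `|y| ≤ 100` to the plane that has period `w` in the direction of the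
strip and collapses the two boundary lines. -/
noncomputable def wrap (w : ℝ) (z : ℝ × ℝ) : Plane :=
  Complex.equivRealProdCLM (stripMap (z.1 * (2 * Real.pi / w), z.2 * 100⁻¹))

/-- The points of the closed strip that `wrap w` does not send to infinity. -/
def Proper (w : ℝ) (z : ℝ × ℝ) : Prop :=
  |z.2| ≤ 100 ∧ (z.2 = 0 → ∀ m : ℤ, z.1 ≠ m * w)

theorem Proper.not_isPole {w : ℝ} (hw : 0 < w) {z : ℝ × ℝ} (hz : Proper w z) :
    ¬ IsPole (z.1 * (2 * Real.pi / w), z.2 * 100⁻¹) := by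
  intro h
  have hy : |z.2 * 100⁻¹| ≤ 1 := by
    rw [abs_mul, abs_of_pos (by norm_num : (0 : ℝ) < 100⁻¹)]
    linarith [hz.1]
  obtain ⟨h0, m, hm⟩ := h.eq hy
  simp only at h0 hm
  refine hz.2 (by linarith) m ?_
  have hpi := Real.pi_pos
  field_simp at hm
  linarith

theorem continuousAt_wrap {w : ℝ} (hw : 0 < w) {z : ℝ × ℝ} (hz : Proper w z) :
    ContinuousAt (wrap w) z := by
  have h1 : ContinuousAt stripMap (z.1 * (2 * Real.pi / w), z.2 * 100⁻¹) :=
    continuousAt_stripMap (hz.not_isPole hw)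
  have h2 : ContinuousAt (fun z : ℝ × ℝ => (z.1 * (2 * Real.pi / w), z.2 * (100⁻¹ : ℝ))) z := by
    fun_prop
  exact Complex.equivRealProdCLM.continuous.continuousAt.comp
    (ContinuousAt.comp (g := stripMap) h1 h2)

theorem wrap_top (w x x' : ℝ) : wrap w (x, 100) = wrap w (x', 100) := by
  simp [wrap, stripMap_top]

theorem wrap_bottom (w x x' : ℝ) : wrap w (x, -100) = wrap w (x', -100) := by
  simp [wrap, stripMap_bottom]

theorem wrap_periodic {w : ℝ} (hw : 0 < w) (x y : ℝ) (m : ℤ) :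
    wrap w (x + m * w, y) = wrap w (x, y) := by
  have : (x + m * w) * (2 * Real.pi / w) = x * (2 * Real.pi / w) + m * (2 * Real.pi) := by
    field_simp
  simp only [wrap, this, stripMap_periodic]

theorem wrap_eq {w : ℝ} (hw : 0 < w) {z z' : ℝ × ℝ} (hz : Proper w z) (hz' : Proper w z')
    (h : wrap w z = wrap w z') :
    z.2 = z'.2 ∧ (|z.2| < 100 → ∃ m : ℤ, z.1 = z'.1 + m * w) := by
  have hy : |z.2 * 100⁻¹| ≤ 1 := by
    rw [abs_mul, abs_of_pos (by norm_num : (0 : ℝ) < 100⁻¹)]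
    linarith [hz.1]
  have hy' : |z'.2 * 100⁻¹| ≤ 1 := by
    rw [abs_mul, abs_of_pos (by norm_num : (0 : ℝ) < 100⁻¹)]
    linarith [hz'.1]
  obtain ⟨h1, h2⟩ := stripMap_eq hy hy' (hz.not_isPole hw) (hz'.not_isPole hw)
    (Complex.equivRealProdCLM.injective h)
  simp only at h1 h2
  refine ⟨by linarith, fun hlt => ?_⟩
  obtain ⟨m, hm⟩ := h2 (by
    rw [abs_mul, abs_of_pos (by norm_num : (0 : ℝ) < 100⁻¹)]
    linarith)
  refine ⟨m, ?_⟩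
  have hpi := Real.pi_pos
  field_simp at hm
  linarith

/-- The bound by half a period is what later singles out one lift of an arc inside the chart. -/
theorem exists_chart_wrap {w : ℝ} (hw : 0 < w) {z : ℝ × ℝ} (hz : Proper w z) (hy : |z.2| < 100) :
    ∃ χ : OpenPartialHomeomorph Plane Plane, z ∈ χ.source ∧ ∀ q ∈ χ.source,
      χ q = wrap w q ∧ Proper w q ∧ |q.2| < 100 ∧ |q.1 - z.1| < w / 2 := by
  have hpi := Real.pi_pos
  have hc : 2 * Real.pi / w ≠ 0 := by positivity
  set Λ : Plane ≃ₜ Plane := (Homeomorph.mulRight₀ (2 * Real.pi / w) hc).prodCongr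
    (Homeomorph.mulRight₀ (100⁻¹ : ℝ) (by norm_num)) with hΛ
  have hΛv : ∀ q : Plane, Λ q = (q.1 * (2 * Real.pi / w), q.2 * 100⁻¹) := fun q => rfl
  set θ := z.1 * (2 * Real.pi / w) with hθ
  have h100 : |(100⁻¹ : ℝ)| = 100⁻¹ := abs_of_pos (by norm_num)
  have hmem : ∀ q : Plane, q ∈ ((Λ.toOpenPartialHomeomorph.trans (stripChart θ)).trans
      Complex.equivRealProdCLM.toHomeomorph.toOpenPartialHomeomorph).source ↔
      Λ q ∈ (stripChart θ).source := by
    intro q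
    simp
  refine ⟨(Λ.toOpenPartialHomeomorph.trans (stripChart θ)).trans
    Complex.equivRealProdCLM.toHomeomorph.toOpenPartialHomeomorph, ?_, ?_⟩
  · rw [hmem, hΛv]
    refine ⟨?_, ?_, hz.not_isPole hw⟩
    · simpa [hθ] using hpi
    · rw [abs_mul, h100]
      linarith
  · intro q hq
    rw [hmem, hΛv] at hq
    obtain ⟨h1, h2, h3⟩ := hq
    rw [abs_mul, h100] at h2
    refine ⟨rfl, ⟨by linarith, fun h0 m hm => h3 ?_⟩, by linarith, ?_⟩
    · have : (q.1 * (2 * Real.pi / w)) = m * (2 * Real.pi) := by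
        rw [hm]; field_simp
      simp only [IsPole, this, h0, zero_mul, sub_zero, add_zero, Complex.ofReal_one, one_mul]
      rw [Complex.exp_eq_one_iff]
      exact ⟨m, by push_cast; ring⟩
    · simp only at h1
      rw [hθ, ← sub_mul, abs_mul, abs_of_pos (by positivity : 0 < 2 * Real.pi / w)] at h1
      have := (lt_div_iff₀ (by positivity : 0 < 2 * Real.pi / w)).2 h1
      refine this.trans_eq ?_
      field_simp

/-! ### Integer coordinates of a wedge and finite checks -/

/-- The strokes of one wedge: ten rim edges, and five diagonals and five spokes in each of its four
pentagons. -/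
abbrev Stroke : Type := Fin 10 ⊕ (Fin 4 × Fin 5) ⊕ (Fin 4 × Fin 5)

instance : DecidableEq Stroke :=
  inferInstanceAs (DecidableEq (Fin 10 ⊕ (Fin 4 × Fin 5) ⊕ (Fin 4 × Fin 5)))

/-- An end of a stroke: one of ten kinds of vertices, in the same wedge (`0`) or in the next one
(`1`), or one of the two poles. -/
abbrev Site : Type := (Fin 10 × ℤ) ⊕ Fin 2

/-- The position of a vertex in the wedge that starts at abscissa `0`. -/
def spot : Fin 10 → ℤ × ℤ :=
  ![(-4, -20), (5, -32), (-5, -48), (4, -60), (13, -35), (11, -45),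
    (6, -21), (8, -41), (17, -39), (17, -59)]

/-- The corners of the four pentagons of a wedge, in cyclic order. -/
def corner : Fin 4 → Fin 5 → Site :=
  ![![.inr 0, .inl (0, 0), .inl (1, 0), .inl (4, 0), .inl (0, 1)],
    ![.inl (1, 0), .inl (4, 0), .inl (5, 0), .inl (3, 0), .inl (2, 0)],
    ![.inl (4, 0), .inl (0, 1), .inl (1, 1), .inl (2, 1), .inl (5, 0)],
    ![.inr 1, .inl (3, 0), .inl (5, 0), .inl (2, 1), .inl (3, 1)]]

/-- The rim edges of a wedge. -/
def rimEnds : Fin 10 → Site × Site :=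
  ![(.inr 0, .inl (0, 0)), (.inl (0, 0), .inl (1, 0)), (.inl (1, 0), .inl (2, 0)),
    (.inl (2, 0), .inl (3, 0)), (.inl (3, 0), .inr 1), (.inl (1, 0), .inl (4, 0)),
    (.inl (4, 0), .inl (0, 1)), (.inl (4, 0), .inl (5, 0)), (.inl (5, 0), .inl (3, 0)),
    (.inl (5, 0), .inl (2, 1))]

/-- The hub of a pentagon. -/
def hub : Fin 4 → Fin 10 := ![6, 7, 8, 9]

/-- The two ends of a stroke. -/
def ends : Stroke → Site × Site
  | .inl j => rimEnds j
  | .inr (.inl (f, j)) => (corner f j, corner f (j + 2))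
  | .inr (.inr (f, j)) => (.inl (hub f, 0), corner f j)

/-- The position of the end `a` of a stroke whose other end is `b`. Poles lie vertically above or
below the other end. -/
def place : Site → Site → ℤ × ℤ
  | .inl (v, o), _ => ((spot v).1 + 24 * o, (spot v).2)
  | .inr p, .inl (v, o) => ((spot v).1 + 24 * o, if p = 0 then 100 else -100)
  | .inr _, .inr _ => (0, 0)

/-- The first endpoint of the segment that represents a stroke. -/
def src (k : Stroke) : ℤ × ℤ := place (ends k).1 (ends k).2

/-- The second endpoint of the segment that represents a stroke. -/
def tgt (k : Stroke) : ℤ × ℤ := place (ends k).2 (ends k).1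

/-- The stroke whose crossing with `k` is assigned to `k`; rim edges are not crossed. -/
def partner : Stroke → Stroke
  | .inl j => .inl j
  | .inr (.inl (f, j)) => .inr (.inl (f, j + 1))
  | .inr (.inr (f, j)) => .inr (.inl (f, j - 1))

/-- Twice the signed area of a triangle. -/
def area (a b c : ℤ × ℤ) : ℤ := (b.1 - a.1) * (c.2 - a.2) - (b.2 - a.2) * (c.1 - a.1)

/-- The segment from `c` to `d` lies weakly on one side of the line through `a` and `b`, and it is
not contained in this line. -/
def OneSided (a b c d : ℤ × ℤ) : Prop :=
  (0 ≤ area a b c ∧ 0 ≤ area a b d ∧ 0 < area a b c + area a b d) ∨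
    (area a b c ≤ 0 ∧ area a b d ≤ 0 ∧ area a b c + area a b d < 0)

instance (a b c d : ℤ × ℤ) : Decidable (OneSided a b c d) := by unfold OneSided; infer_instance

/-- A certificate for the disjointness of two open segments. -/
def Separated (a b c d : ℤ × ℤ) : Prop :=
  OneSided a b c d ∨ OneSided c d a b ∨ (a.1 ≠ b.1 ∧ max a.1 b.1 ≤ min c.1 d.1)

instance (a b c d : ℤ × ℤ) : Decidable (Separated a b c d) := by unfold Separated; infer_instance

/-- A certificate for a point not to lie on an open segment. -/
def Avoids (a b c : ℤ × ℤ) : Prop :=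
  area a b c ≠ 0 ∨ (a.1 ≠ b.1 ∧ (c.1 ≤ min a.1 b.1 ∨ max a.1 b.1 ≤ c.1)) ∨
    (a.2 ≠ b.2 ∧ (c.2 ≤ min a.2 b.2 ∨ max a.2 b.2 ≤ c.2))

instance (a b c : ℤ × ℤ) : Decidable (Avoids a b c) := by unfold Avoids; infer_instance

theorem separated_of_ne (k l : Stroke) (h : k ≠ l) :
    Separated (src k) (tgt k) (src l) (tgt l) ∨ partner k = l ∨ partner l = k := by
  revert k l; decide +kernel

/-- Translates by two or more wedges are apart by `stroke_bounds`, so neighbouring wedges suffice.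
The third alternative of `Separated` serves collinear segments, such as a horizontal diagonal
joining a vertex to its copy in the next wedge, followed by its own translate. -/
theorem separated_shift (k l : Stroke) :
    Separated (src k) (tgt k) (src l + (24, 0)) (tgt l + (24, 0)) := by
  revert k l; decide +kernel

theorem avoids_spot (k : Stroke) (v : Fin 10) (o : Fin 3) :
    Avoids (src k) (tgt k) (spot v + (24 * (o - 1 : ℤ), 0)) := by
  revert k v o; decide +kernel

theorem partner_not_parallel (k : Stroke) (h : partner k ≠ k) :
    ((tgt k).1 - (src k).1) * ((tgt (partner k)).2 - (src (partner k)).2) -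
      ((tgt k).2 - (src k).2) * ((tgt (partner k)).1 - (src (partner k)).1) ≠ 0 := by
  revert k; decide +kernel

/-- In each pentagon the partner relation is a 5-cycle of diagonals with one pendant spoke at each.
This excludes triple crossings without computing any crossing point. -/
theorem no_partner_triangle (j k l : Stroke) (hjk : j ≠ k) (hkl : k ≠ l) (hjl : j ≠ l)
    (h₁ : partner j = k ∨ partner k = j) (h₂ : partner k = l ∨ partner l = k) :
    ¬ (partner j = l ∨ partner l = j) := by
  revert j k l; decide +kernel

theorem stroke_bounds (k : Stroke) :
    (-5 ≤ (src k).1 ∧ (src k).1 ≤ 29) ∧ (-5 ≤ (tgt k).1 ∧ (tgt k).1 ≤ 29) ∧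
    (-100 ≤ (src k).2 ∧ (src k).2 ≤ 100) ∧ (-100 ≤ (tgt k).2 ∧ (tgt k).2 ≤ 100) ∧
    ((-100 < (src k).2 ∧ (src k).2 < 100) ∨ (-100 < (tgt k).2 ∧ (tgt k).2 < 100)) := by
  revert k; decide +kernel

theorem stroke_nondegenerate (k : Stroke) :
    (src k).2 ≠ (tgt k).2 ∨
      ((src k).1 ≠ (tgt k).1 ∧ -100 < (src k).2 ∧ (src k).2 < 100) := by
  revert k; decide +kernel

/-- Only strokes to the upper pole reach height 0. They are vertical and miss the multiples of 24,
among which are all points sent to infinity. -/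
theorem stroke_height (k : Stroke) :
    ((src k).2 < 0 ∧ (tgt k).2 < 0) ∨ ((src k).1 = (tgt k).1 ∧ ¬ (24 : ℤ) ∣ (src k).1) := by
  revert k; decide +kernel

theorem spot_bounds (v : Fin 10) : -5 ≤ (spot v).1 ∧ (spot v).1 ≤ 29 ∧ -100 < (spot v).2 ∧
    (spot v).2 < 0 := by
  revert v; decide +kernel

theorem spot_snd_injective (v w : Fin 10) (h : (spot v).2 = (spot w).2) : v = w := by
  revert v w; decide +kernel

/-- The kind of vertex at an end of a stroke, regardless of the wedge. -/
def Site.kind : Site → Fin 10 ⊕ Fin 2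
  | .inl (v, _) => .inl v
  | .inr p => .inr p

/-- The wedge of an end of a stroke, relative to the wedge of the stroke. -/
def Site.offset : Site → ℤ
  | .inl (_, o) => o
  | .inr _ => 0

/-- Two pairs of sites are incompatible: they cannot become equal by a shift. -/
def Clash (a b a' b' : Site) : Prop :=
  a.kind ≠ a'.kind ∨ b.kind ≠ b'.kind ∨
    (a.kind.isLeft ∧ b.kind.isLeft ∧ a.offset - a'.offset ≠ b.offset - b'.offset)

instance (a b a' b' : Site) : Decidable (Clash a b a' b') := by unfold Clash; infer_instance

theorem clash_of_ne (k l : Stroke) (h : k ≠ l) :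
    Clash (ends k).1 (ends k).2 (ends l).1 (ends l).2 := by
  revert k l; decide +kernel

theorem clash_swap (k l : Stroke) :
    Clash (ends k).1 (ends k).2 (ends l).2 (ends l).1 := by
  revert k l; decide +kernel

theorem ends_ne (k : Stroke) : (ends k).1.kind ≠ (ends k).2.kind ∨
    ((ends k).1.kind.isLeft ∧ (ends k).1.offset ≠ (ends k).2.offset) := by
  revert k; decide +kernel

theorem ends_isLeft (k : Stroke) : (ends k).1.kind.isLeft ∨ (ends k).2.kind.isLeft := by
  revert k; decide +kernel

theorem offset_bounds (k : Stroke) : (0 ≤ (ends k).1.offset ∧ (ends k).1.offset ≤ 1) ∧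
    (0 ≤ (ends k).2.offset ∧ (ends k).2.offset ≤ 1) := by
  revert k; decide +kernel

/-! ### From integer certificates to real segments -/

/-- The point with parameter `t` on the segment from `a` to `b`. -/
def along (a b : ℤ × ℤ) (t : ℝ) : ℝ × ℝ :=
  (a.1 + t * (b.1 - a.1), a.2 + t * (b.2 - a.2))

theorem convex_combination_mem {a b lo hi t : ℝ} (ht : t ∈ Set.Icc (0 : ℝ) 1)
    (ha : lo ≤ a ∧ a ≤ hi) (hb : lo ≤ b ∧ b ≤ hi) :
    lo ≤ a + t * (b - a) ∧ a + t * (b - a) ≤ hi := by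
  obtain ⟨h0, h1⟩ := ht
  constructor
  · nlinarith [mul_nonneg h0 (sub_nonneg.2 hb.1), mul_nonneg (sub_nonneg.2 h1) (sub_nonneg.2 ha.1)]
  · nlinarith [mul_nonneg h0 (sub_nonneg.2 hb.2), mul_nonneg (sub_nonneg.2 h1) (sub_nonneg.2 ha.2)]

theorem convex_combination_lt {a b c t : ℝ} (ht : t ∈ Set.Ioo (0 : ℝ) 1)
    (ha : a ≤ c) (hb : b ≤ c) (h : a < c ∨ b < c) : a + t * (b - a) < c := by
  obtain ⟨h0, h1⟩ := ht
  rcases h with h | h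
  · nlinarith [mul_nonneg h0.le (sub_nonneg.2 hb), mul_pos (sub_pos.2 h1) (sub_pos.2 h)]
  · nlinarith [mul_pos h0 (sub_pos.2 h), mul_nonneg (sub_nonneg.2 h1.le) (sub_nonneg.2 ha)]

theorem lt_convex_combination {a b c t : ℝ} (ht : t ∈ Set.Ioo (0 : ℝ) 1)
    (ha : c ≤ a) (hb : c ≤ b) (h : c < a ∨ c < b) : c < a + t * (b - a) := by
  have := convex_combination_lt (a := -a) (b := -b) (c := -c) ht (by linarith) (by linarith)
    (h.imp (fun h => by linarith) fun h => by linarith)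
  linarith

/-- The signed area with base `a`, `b` is affine in the third point. It vanishes on the line through
`a` and `b` but has a strict sign inside the other segment. -/
theorem OneSided.along_ne {a b c e : ℤ × ℤ} (h : OneSided a b c e) {t s : ℝ}
    (hs : s ∈ Set.Ioo (0 : ℝ) 1) : along a b t ≠ along c e s := by
  intro heq
  have h1 := congrArg Prod.fst heq
  have h2 := congrArg Prod.snd heq
  simp only [along] at h1 h2
  have key : (area a b c : ℝ) + s * (area a b e - area a b c) = 0 := by
    simp only [area]
    push_cast
    linear_combination ((b.1 : ℝ) - a.1) * (-h2) + ((b.2 : ℝ) - a.2) * h1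
  rcases h with ⟨hc, he, hp⟩ | ⟨hc, he, hp⟩
  · refine (lt_convex_combination (a := (area a b c : ℝ)) (b := area a b e) hs
      (by exact_mod_cast hc) (by exact_mod_cast he) ?_).ne' key
    rcases lt_or_eq_of_le hc with h | h
    · exact Or.inl (by exact_mod_cast h)
    · exact Or.inr (by exact_mod_cast (by omega : 0 < area a b e))
  · refine (convex_combination_lt (a := (area a b c : ℝ)) (b := area a b e) hs
      (by exact_mod_cast hc) (by exact_mod_cast he) ?_).ne key
    rcases lt_or_eq_of_le hc with h | h
    · exact Or.inl (by exact_mod_cast h)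
    · exact Or.inr (by exact_mod_cast (by omega : area a b e < 0))

theorem Separated.along_ne {a b c e : ℤ × ℤ} (h : Separated a b c e) {t s : ℝ}
    (ht : t ∈ Set.Ioo (0 : ℝ) 1) (hs : s ∈ Set.Ioo (0 : ℝ) 1) : along a b t ≠ along c e s := by
  rcases h with h | h | ⟨hne, h⟩
  · exact h.along_ne hs
  · exact (h.along_ne ht).symm
  · intro heq
    have h1 := congrArg Prod.fst heq
    simp only [along] at h1
    have hne' : a.1 < max a.1 b.1 ∨ b.1 < max a.1 b.1 := by
      rcases lt_or_gt_of_ne hne with h | h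
      · exact Or.inl (lt_max_of_lt_right h)
      · exact Or.inr (lt_max_of_lt_left h)
    have h2 := convex_combination_lt (a := (a.1 : ℝ)) (b := b.1) (c := (max a.1 b.1 : ℤ)) ht
      (by exact_mod_cast le_max_left _ _) (by exact_mod_cast le_max_right _ _)
      (by exact_mod_cast hne')
    have h3 := (convex_combination_mem (a := (c.1 : ℝ)) (b := e.1) (lo := (min c.1 e.1 : ℤ))
      (hi := (max c.1 e.1 : ℤ)) ⟨hs.1.le, hs.2.le⟩
      ⟨by exact_mod_cast min_le_left _ _, by exact_mod_cast le_max_left _ _⟩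
      ⟨by exact_mod_cast min_le_right _ _, by exact_mod_cast le_max_right _ _⟩).1
    have h4 : ((max a.1 b.1 : ℤ) : ℝ) ≤ (min c.1 e.1 : ℤ) := by exact_mod_cast h
    linarith

theorem convex_combination_ne {a b c : ℤ} {t : ℝ} (ht : t ∈ Set.Ioo (0 : ℝ) 1) (hne : a ≠ b)
    (h : c ≤ min a b ∨ max a b ≤ c) : (a : ℝ) + t * (b - a) ≠ c := by
  rcases h with h | h
  · obtain ⟨h1, h2⟩ := le_min_iff.1 h
    exact (lt_convex_combination ht (by exact_mod_cast h1) (by exact_mod_cast h2)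
      (by norm_cast; omega)).ne'
  · obtain ⟨h1, h2⟩ := max_le_iff.1 h
    exact (convex_combination_lt ht (by exact_mod_cast h1) (by exact_mod_cast h2)
      (by norm_cast; omega)).ne

theorem Avoids.along_ne {a b c : ℤ × ℤ} (h : Avoids a b c) {t : ℝ} (ht : t ∈ Set.Ioo (0 : ℝ) 1) :
    along a b t ≠ ((c.1 : ℝ), (c.2 : ℝ)) := by
  intro heq
  have h1 := congrArg Prod.fst heq
  have h2 := congrArg Prod.snd heq
  simp only [along] at h1 h2
  rcases h with h | ⟨hne, h⟩ | ⟨hne, h⟩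
  · apply h
    have : (area a b c : ℝ) = 0 := by
      simp only [area]
      push_cast
      linear_combination ((b.1 : ℝ) - a.1) * (-h2) + ((b.2 : ℝ) - a.2) * h1
    exact_mod_cast this
  · exact convex_combination_ne ht hne h h1
  · exact convex_combination_ne ht hne h h2

/-- The point with parameter `t` on a stroke of the wedge that starts at abscissa `0`. -/
def track (k : Stroke) (t : ℝ) : ℝ × ℝ := along (src k) (tgt k) t

theorem track_bounds (k : Stroke) {t : ℝ} (ht : t ∈ Set.Icc (0 : ℝ) 1) :
    (-5 ≤ (track k t).1 ∧ (track k t).1 ≤ 29) ∧ |(track k t).2| ≤ 100 := by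
  obtain ⟨h1, h2, h3, h4, -⟩ := stroke_bounds k
  rw [abs_le]
  exact ⟨convex_combination_mem ht (by exact_mod_cast h1) (by exact_mod_cast h2),
    convex_combination_mem ht (by exact_mod_cast h3) (by exact_mod_cast h4)⟩

theorem abs_track_snd_lt (k : Stroke) {t : ℝ} (ht : t ∈ Set.Ioo (0 : ℝ) 1) :
    |(track k t).2| < 100 := by
  obtain ⟨-, -, h3, h4, h5⟩ := stroke_bounds k
  rw [abs_lt]
  constructor
  · exact lt_convex_combination ht (by exact_mod_cast h3.1) (by exact_mod_cast h4.1)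
      (h5.imp (fun h => by exact_mod_cast h.1) fun h => by exact_mod_cast h.1)
  · exact convex_combination_lt ht (by exact_mod_cast h3.2) (by exact_mod_cast h4.2)
      (h5.imp (fun h => by exact_mod_cast h.2) fun h => by exact_mod_cast h.2)

/-- Shift a point of the strip by `z` wedges. -/
def shift (z : ℤ) (p : ℝ × ℝ) : ℝ × ℝ := (24 * z + p.1, p.2)

theorem proper_shift_track (d : ℕ) (z : ℤ) (k : Stroke) {t : ℝ} (ht : t ∈ Set.Icc (0 : ℝ) 1) :
    Proper (24 * d) (shift z (track k t)) := by
  refine ⟨(track_bounds k ht).2, fun h0 m hm => ?_⟩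
  simp only [shift, track, along] at h0 hm
  rcases stroke_height k with ⟨h1, h2⟩ | ⟨h1, h2⟩
  · have h1' : ((src k).2 : ℝ) < 0 := by exact_mod_cast h1
    have h2' : ((tgt k).2 : ℝ) < 0 := by exact_mod_cast h2
    have := (convex_combination_mem ht ⟨min_le_left _ _, le_max_left ((src k).2 : ℝ) (tgt k).2⟩
      ⟨min_le_right _ _, le_max_right _ _⟩).2
    rw [h0] at this
    exact absurd (max_lt h1' h2') (not_lt.2 this)
  · rw [h1, sub_self, mul_zero, add_zero, ← h1] at hm
    apply h2
    refine ⟨m * d - z, ?_⟩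
    have : (24 * z + (src k).1 : ℝ) = (m * (24 * d) : ℝ) := hm
    have h3 : 24 * z + (src k).1 = m * (24 * d) := by exact_mod_cast this
    linear_combination h3

/-- The position of the vertex `v` of the wedge that starts at abscissa `0`. -/
def spotPoint (v : Fin 10) : ℝ × ℝ := ((spot v).1, (spot v).2)

theorem proper_shift_spotPoint (d : ℕ) (z : ℤ) (v : Fin 10) :
    Proper (24 * d) (shift z (spotPoint v)) := by
  obtain ⟨-, -, h1, h2⟩ := spot_bounds v
  have h1' : (-100 : ℝ) < (spot v).2 := by exact_mod_cast h1
  have h2' : ((spot v).2 : ℝ) < 0 := by exact_mod_cast h2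
  exact ⟨abs_le.2 ⟨h1'.le, by simp only [shift, spotPoint]; linarith⟩, fun h0 => absurd h0 h2'.ne⟩

theorem abs_spotPoint_snd_lt (v : Fin 10) : |(spotPoint v).2| < 100 := by
  obtain ⟨-, -, h1, h2⟩ := spot_bounds v
  have h1' : (-100 : ℝ) < (spot v).2 := by exact_mod_cast h1
  have h2' : ((spot v).2 : ℝ) < 0 := by exact_mod_cast h2
  exact abs_lt.2 ⟨h1', by simp only [spotPoint]; linarith⟩

theorem along_add (a b : ℤ × ℤ) (z : ℤ) (t : ℝ) :
    along (a + (24 * z, 0)) (b + (24 * z, 0)) t = shift z (along a b t) := by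
  refine Prod.ext ?_ ?_
  · simp only [along, shift, Prod.fst_add]
    push_cast
    ring
  · simp only [along, shift, Prod.snd_add, add_zero]

theorem shift_track_one_ne (k l : Stroke) {t s : ℝ} (ht : t ∈ Set.Ioo (0 : ℝ) 1)
    (hs : s ∈ Set.Ioo (0 : ℝ) 1) : track k t ≠ shift 1 (track l s) := by
  have := (separated_shift k l).along_ne ht hs
  have h := along_add (src l) (tgt l) 1 s
  norm_num at h
  rwa [h] at this

/-- Strokes of different wedges do not meet. -/
theorem shift_eq_zero_of_track_eq {k l : Stroke} {t s : ℝ} (ht : t ∈ Set.Ioo (0 : ℝ) 1)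
    (hs : s ∈ Set.Ioo (0 : ℝ) 1) {z : ℤ} (h : track k t = shift z (track l s)) : z = 0 := by
  obtain ⟨h1, h2⟩ := (track_bounds k ⟨ht.1.le, ht.2.le⟩).1
  obtain ⟨h3, h4⟩ := (track_bounds l ⟨hs.1.le, hs.2.le⟩).1
  have h5 := congrArg Prod.fst h
  simp only [shift] at h5
  -- All abscissas lie between -5 and 29, an interval of length 34 < 2 · 24.
  have h6 : (z : ℝ) < 2 := by linarith
  have h7 : (-2 : ℝ) < z := by linarith
  have h6' : z < 2 := by exact_mod_cast h6
  have h7' : -2 < z := by exact_mod_cast h7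
  by_contra h0
  obtain rfl | rfl : z = 1 ∨ z = -1 := by omega
  · exact shift_track_one_ne k l ht hs h
  · refine shift_track_one_ne l k hs ht ?_
    rw [h]
    refine Prod.ext ?_ rfl
    simp only [shift]
    push_cast
    ring

theorem track_ne_shift_spotPoint (k : Stroke) (v : Fin 10) {t : ℝ} (ht : t ∈ Set.Ioo (0 : ℝ) 1)
    (z : ℤ) : track k t ≠ shift z (spotPoint v) := by
  intro h
  obtain ⟨h1, h2⟩ := (track_bounds k ⟨ht.1.le, ht.2.le⟩).1
  obtain ⟨h3, h4, -⟩ := spot_bounds v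
  have h3' : (-5 : ℝ) ≤ (spot v).1 := by exact_mod_cast h3
  have h4' : ((spot v).1 : ℝ) ≤ 29 := by exact_mod_cast h4
  have h5 := congrArg Prod.fst h
  simp only [shift, spotPoint] at h5
  have h6 : (z : ℝ) < 2 := by linarith
  have h7 : (-2 : ℝ) < z := by linarith
  have h6' : z < 2 := by exact_mod_cast h6
  have h7' : -2 < z := by exact_mod_cast h7
  obtain ⟨o, ho⟩ : ∃ o : Fin 3, (o : ℤ) - 1 = z := by
    obtain rfl | rfl | rfl : z = -1 ∨ z = 0 ∨ z = 1 := by omega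
    · exact ⟨0, rfl⟩
    · exact ⟨1, rfl⟩
    · exact ⟨2, rfl⟩
  have := (avoids_spot k v o).along_ne ht
  rw [ho] at this
  apply this
  rw [← track, h]
  refine Prod.ext ?_ ?_
  · simp only [shift, spotPoint, Prod.fst_add]
    push_cast
    ring
  · simp only [shift, spotPoint, Prod.snd_add, add_zero]

/-- The height determines the parameter unless the stroke is horizontal; a horizontal stroke avoids
the collapsed boundary lines, so there the abscissa is available. -/
theorem track_injOn (k : Stroke) {t s : ℝ} (h2 : (track k t).2 = (track k s).2)
    (h1 : |(track k t).2| < 100 → (track k t).1 = (track k s).1) : t = s := by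
  simp only [track, along] at h1 h2
  rcases stroke_nondegenerate k with h | ⟨h, hlo, hhi⟩
  · have h' : ((tgt k).2 : ℝ) - (src k).2 ≠ 0 := sub_ne_zero.2 (by exact_mod_cast h.symm)
    exact mul_right_cancel₀ h' (by linarith)
  · by_cases h3 : (src k).2 = (tgt k).2
    · have h' : ((tgt k).1 : ℝ) - (src k).1 ≠ 0 := sub_ne_zero.2 (by exact_mod_cast h.symm)
      have hlt : |((src k).2 : ℝ) + t * ((tgt k).2 - (src k).2)| < 100 := by
        rw [h3, sub_self, mul_zero, add_zero, ← h3, abs_lt]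
        exact ⟨by exact_mod_cast hlo, by exact_mod_cast hhi⟩
      exact mul_right_cancel₀ h' (by linarith [h1 hlt])
    · have h' : ((tgt k).2 : ℝ) - (src k).2 ≠ 0 :=
        sub_ne_zero.2 (by exact_mod_cast Ne.symm h3)
      exact mul_right_cancel₀ h' (by linarith)

/-! ### The cyclic arrangement of wedges -/

section Wheel

set_option linter.unusedSectionVars false

variable (d : ℕ) [NeZero d]

/-- The vertices of `d` wedges with all hubs, and the two poles. -/
abbrev WheelVertex : Type := (ZMod d × Fin 10) ⊕ Fin 2

/-- The vertex at a site of the wedge `i`. -/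
def siteVertex (i : ZMod d) : Site → WheelVertex d
  | .inl (v, o) => .inl (i + o, v)
  | .inr p => .inr p

/-- The point that represents a vertex. -/
noncomputable def wheelPoint : WheelVertex d → Plane
  | .inl (i, v) => wrap (24 * d) (shift i.val (spotPoint v))
  | .inr p => wrap (24 * d) (0, if p = 0 then 100 else -100)

/-- The arc that represents the stroke `k` of the wedge `i`. -/
noncomputable def wheelArc (e : ZMod d × Stroke) (t : unitInterval) : Plane :=
  wrap (24 * d) (shift e.1.val (track e.2 t))

variable {d}

theorem circumference_pos : (0 : ℝ) < 24 * d := by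
  have : 0 < d := Nat.pos_of_ne_zero (NeZero.ne d)
  positivity

theorem wrap_shift_eq (z w : ℤ) (h : (z : ZMod d) = w) (p : ℝ × ℝ) :
    wrap (24 * d) (shift z p) = wrap (24 * d) (shift w p) := by
  obtain ⟨m, hm⟩ := (ZMod.intCast_eq_intCast_iff_dvd_sub z w d).1 h
  have hw : (w : ℝ) = z + d * m := by exact_mod_cast (by linarith : w = z + d * m)
  rw [shift, shift, ← wrap_periodic circumference_pos _ _ m, hw]
  congr 2
  ring

/-- Equality of images under the wrapping map, for points that are given by a wedge and a position
in this wedge. -/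
theorem wrap_shift_eq_iff {i j : ZMod d} {p q : ℝ × ℝ} (hp : Proper (24 * d) (shift i.val p))
    (hq : Proper (24 * d) (shift j.val q)) (hy : |p.2| < 100)
    (h : wrap (24 * d) (shift i.val p) = wrap (24 * d) (shift j.val q)) :
    ∃ z : ℤ, p = shift z q ∧ i + z = j := by
  obtain ⟨h2, h1⟩ := wrap_eq circumference_pos hp hq h
  obtain ⟨m, hm⟩ := h1 hy
  refine ⟨j.val - i.val + m * d, Prod.ext ?_ h2, ?_⟩
  · simp only [shift] at hm ⊢
    push_cast at hm ⊢
    linarith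
  · push_cast
    simp

theorem proper_pole (w : ℝ) (p : Fin 2) : Proper w (0, if p = 0 then 100 else -100) := by
  refine ⟨?_, fun h0 => ?_⟩
  · dsimp only; split_ifs <;> norm_num
  · dsimp only at h0; split_ifs at h0 <;> norm_num at h0

theorem wheelPoint_injective : Function.Injective (wheelPoint d) := by
  have hmixed : ∀ (i : ZMod d) (v : Fin 10) (p : Fin 2),
      wheelPoint d (.inl (i, v)) ≠ wheelPoint d (.inr p) := by
    intro i v p h
    have h2 := (wrap_eq circumference_pos (proper_shift_spotPoint d _ v) (proper_pole _ p) h).1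
    have h3 := abs_spotPoint_snd_lt v
    rw [show (spotPoint v).2 = _ from h2] at h3
    dsimp only at h3
    split_ifs at h3 <;> norm_num at h3
  rintro (⟨i, v⟩ | p) (⟨j, w⟩ | q) h
  · obtain ⟨z, h1, h2⟩ := wrap_shift_eq_iff (proper_shift_spotPoint d _ v)
      (proper_shift_spotPoint d _ w) (abs_spotPoint_snd_lt v) h
    have h3 : ((spot v).2 : ℝ) = (spot w).2 := congrArg Prod.snd h1
    obtain rfl := spot_snd_injective v w (by exact_mod_cast h3)
    have h4 := congrArg Prod.fst h1
    simp only [shift] at h4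
    have h5 : (z : ℝ) = 0 := by linarith
    have h6 : z = 0 := by exact_mod_cast h5
    rw [h6, Int.cast_zero, add_zero] at h2
    rw [h2]
  · exact absurd h (hmixed i v q)
  · exact absurd h.symm (hmixed j w p)
  · have h2 := (wrap_eq circumference_pos (proper_pole _ p) (proper_pole _ q) h).1
    dsimp only at h2
    congr 1
    revert h2
    fin_cases p <;> fin_cases q <;> norm_num

/-- A pole may be represented at any abscissa of its boundary line, since the line is collapsed. The
hypothesis excludes the default value of `place` at two poles. -/
theorem wheelPoint_siteVertex (i : ZMod d) (a b : Site) (hab : a.kind.isLeft ∨ b.kind.isLeft) :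
    wrap (24 * d) (shift i.val ((place a b).1, (place a b).2)) =
      wheelPoint d (siteVertex d i a) := by
  rcases a with ⟨v, o⟩ | p
  · have := wrap_shift_eq (d := d) (i.val + o) ((i + o : ZMod d).val) (by simp) (spotPoint v)
    simp only [siteVertex, wheelPoint]
    refine Eq.trans ?_ this
    congr 1
    refine Prod.ext ?_ ?_
    · simp only [shift, place, spotPoint]
      push_cast
      ring
    · simp only [shift, place, spotPoint]
  · rcases b with ⟨v, o⟩ | q
    · simp only [siteVertex, wheelPoint, place, shift]
      split_ifs
      · exact_mod_cast wrap_top _ _ _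
      · exact_mod_cast wrap_bottom _ _ _
    · simp [Site.kind] at hab

/-- Offsets are 0 or 1, so the two offset differences differ by at most 2; with `d ≥ 3` they are
congruent modulo `d` only if equal. -/
theorem Clash.ne {a b a' b' : Site} (h : Clash a b a' b') (hd : 3 ≤ d)
    (ha : 0 ≤ a.offset ∧ a.offset ≤ 1) (hb : 0 ≤ b.offset ∧ b.offset ≤ 1)
    (ha' : 0 ≤ a'.offset ∧ a'.offset ≤ 1) (hb' : 0 ≤ b'.offset ∧ b'.offset ≤ 1)
    (i j : ZMod d) (h₁ : siteVertex d i a = siteVertex d j a') :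
    siteVertex d i b ≠ siteVertex d j b' := by
  intro h₂
  have hkind : ∀ {s s' : Site}, siteVertex d i s = siteVertex d j s' → s.kind = s'.kind := by
    rintro (⟨v, o⟩ | p) (⟨w, o'⟩ | q) h <;> simp_all [siteVertex, Site.kind]
  have hoff : ∀ {s s' : Site}, s.kind.isLeft → siteVertex d i s = siteVertex d j s' →
      ((s.offset - s'.offset : ℤ) : ZMod d) = j - i := by
    rintro (⟨v, o⟩ | p) (⟨w, o'⟩ | q) hl h
    · simp only [siteVertex, Sum.inl.injEq, Prod.mk.injEq] at h
      simp only [Site.offset]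
      push_cast
      linear_combination h.1
    all_goals simp [siteVertex, Site.kind] at h hl
  rcases h with h | h | ⟨hl, hl', h⟩
  · exact h (hkind h₁)
  · exact h (hkind h₂)
  · have := (hoff hl h₁).trans (hoff hl' h₂).symm
    obtain ⟨m, hm⟩ := (ZMod.intCast_eq_intCast_iff_dvd_sub _ _ d).1 this
    have hd' : (3 : ℤ) ≤ d := by exact_mod_cast hd
    have hm0 : m = 0 := by
      by_contra h0
      rcases lt_or_gt_of_ne h0 with h0 | h0
      · nlinarith
      · nlinarith
    rw [hm0] at hm
    omega

theorem wheel_ends_injective (hd : 3 ≤ d) : Function.Injective fun e : ZMod d × Stroke =>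
    s(siteVertex d e.1 (ends e.2).1, siteVertex d e.1 (ends e.2).2) := by
  rintro ⟨i, k⟩ ⟨j, l⟩ h
  obtain ⟨hk₁, hk₂⟩ := offset_bounds k
  obtain ⟨hl₁, hl₂⟩ := offset_bounds l
  rcases Sym2.eq_iff.1 h with ⟨h₁, h₂⟩ | ⟨h₁, h₂⟩
  · by_cases hkl : k = l
    · subst hkl
      have hij : ∀ s : Site, s.kind.isLeft → siteVertex d i s = siteVertex d j s → i = j := by
        rintro (⟨v, o⟩ | p) hs h
        · simpa [siteVertex] using h
        · simp [Site.kind] at hs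
      rcases ends_isLeft k with hk | hk
      · rw [hij _ hk h₁]
      · rw [hij _ hk h₂]
    · exact absurd h₂ ((clash_of_ne k l hkl).ne hd hk₁ hk₂ hl₁ hl₂ i j h₁)
  · exact absurd h₂ ((clash_swap k l).ne hd hk₁ hk₂ hl₂ hl₁ i j h₁)

theorem siteVertex_ends_ne (hd : 3 ≤ d) (i : ZMod d) (k : Stroke) :
    siteVertex d i (ends k).1 ≠ siteVertex d i (ends k).2 := by
  intro h
  obtain ⟨⟨h1, h2⟩, h3, h4⟩ := offset_bounds k
  have hne := ends_ne k
  revert h h1 h2 h3 h4 hne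
  generalize (ends k).1 = a
  generalize (ends k).2 = b
  intro h h1 h2 h3 h4 hne
  rcases a with ⟨v, o⟩ | p <;> rcases b with ⟨w, o'⟩ | q
  · simp only [siteVertex, Sum.inl.injEq, Prod.mk.injEq, add_right_inj] at h
    simp only [Site.kind, Site.offset] at hne h1 h2 h3 h4
    obtain ⟨m, hm⟩ := (ZMod.intCast_eq_intCast_iff_dvd_sub _ _ d).1 h.1
    have hd' : (3 : ℤ) ≤ d := by exact_mod_cast hd
    have hm0 : m = 0 := by
      by_contra h0
      rcases lt_or_gt_of_ne h0 with h0 | h0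
      · nlinarith
      · nlinarith
    rw [hm0] at hm
    rcases hne with hne | hne
    · exact hne (by rw [h.2])
    · exact hne.2 (by omega)
  all_goals simp_all [siteVertex, Site.kind]

theorem wheelArc_zero (i : ZMod d) (k : Stroke) :
    wheelArc d (i, k) 0 = wheelPoint d (siteVertex d i (ends k).1) := by
  rw [← wheelPoint_siteVertex i _ _ (ends_isLeft k)]
  simp [wheelArc, track, along, src]

theorem wheelArc_one (i : ZMod d) (k : Stroke) :
    wheelArc d (i, k) 1 = wheelPoint d (siteVertex d i (ends k).2) := by
  rw [← wheelPoint_siteVertex i _ _ (ends_isLeft k).symm]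
  simp [wheelArc, track, along, tgt]

theorem continuous_wheelArc (e : ZMod d × Stroke) : Continuous (wheelArc d e) := by
  rw [continuous_iff_continuousAt]
  intro t
  refine ContinuousAt.comp (g := wrap (24 * d))
    (continuousAt_wrap circumference_pos (proper_shift_track d _ e.2 t.2)) ?_
  unfold shift track along
  fun_prop

theorem eq_zero_of_track_eq_shift (hd : 3 ≤ d) {k : Stroke} {t s : ℝ} (ht : t ∈ Set.Icc (0 : ℝ) 1)
    (hs : s ∈ Set.Icc (0 : ℝ) 1) {z : ℤ} (hz : (z : ZMod d) = 0)
    (h : track k t = shift z (track k s)) : z = 0 := by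
  obtain ⟨h1, h2⟩ := (track_bounds k ht).1
  obtain ⟨h3, h4⟩ := (track_bounds k hs).1
  have h5 := congrArg Prod.fst h
  simp only [shift] at h5
  obtain ⟨m, rfl⟩ := (ZMod.intCast_zmod_eq_zero_iff_dvd z d).1 hz
  have h6 : ((d * m : ℤ) : ℝ) < 2 := by linarith
  have h7 : (-2 : ℝ) < (d * m : ℤ) := by linarith
  have h6' : (d * m : ℤ) < 2 := by exact_mod_cast h6
  have h7' : -2 < (d * m : ℤ) := by exact_mod_cast h7
  have hd' : (3 : ℤ) ≤ d := by exact_mod_cast hd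
  have hm0 : m = 0 := by
    by_contra h0
    rcases lt_or_gt_of_ne h0 with h0 | h0
    · nlinarith
    · nlinarith
  rw [hm0, mul_zero]

theorem wheelArc_injective (hd : 3 ≤ d) (e : ZMod d × Stroke) :
    Function.Injective (wheelArc d e) := by
  intro t s h
  have hp := proper_shift_track d e.1.val e.2 t.2
  have hq := proper_shift_track d e.1.val e.2 s.2
  apply Subtype.ext
  refine track_injOn e.2 (wrap_eq circumference_pos hp hq h).1 fun hy => ?_
  obtain ⟨z, h1, h2⟩ := wrap_shift_eq_iff hp hq hy h
  have hz := eq_zero_of_track_eq_shift hd t.2 s.2 (by simpa using h2) h1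
  rw [h1, hz]
  simp [shift]

theorem wheelArc_ne_wheelPoint (e : ZMod d × Stroke) {t : unitInterval}
    (ht : t ∈ Set.Ioo (0 : unitInterval) 1) (v : WheelVertex d) :
    wheelArc d e t ≠ wheelPoint d v := by
  intro h
  have ht' : (t : ℝ) ∈ Set.Ioo (0 : ℝ) 1 := ht
  have hp := proper_shift_track d e.1.val e.2 t.2
  have hy := abs_track_snd_lt e.2 ht'
  rcases v with ⟨j, v⟩ | p
  · obtain ⟨z, h1, -⟩ := wrap_shift_eq_iff hp (proper_shift_spotPoint d _ v) hy h
    exact track_ne_shift_spotPoint e.2 v ht' z h1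
  · have h2 := (wrap_eq circumference_pos hp (proper_pole _ p) h).1
    rw [show (track e.2 t).2 = _ from h2] at hy
    dsimp only at hy
    split_ifs at hy <;> norm_num at hy

/-- Arcs meet only within a wedge, at common points of two strokes. -/
theorem eq_of_wheelArc_eq {e f : ZMod d × Stroke} {t s : unitInterval}
    (ht : t ∈ Set.Ioo (0 : unitInterval) 1) (hs : s ∈ Set.Ioo (0 : unitInterval) 1)
    (h : wheelArc d e t = wheelArc d f s) : e.1 = f.1 ∧ track e.2 t = track f.2 s := by
  have ht' : (t : ℝ) ∈ Set.Ioo (0 : ℝ) 1 := ht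
  have hs' : (s : ℝ) ∈ Set.Ioo (0 : ℝ) 1 := hs
  obtain ⟨z, h1, h2⟩ := wrap_shift_eq_iff (proper_shift_track d e.1.val e.2 t.2)
    (proper_shift_track d f.1.val f.2 s.2) (abs_track_snd_lt e.2 ht') h
  obtain rfl := shift_eq_zero_of_track_eq ht' hs' h1
  refine ⟨by simpa using h2, ?_⟩
  rw [h1]
  simp [shift]

theorem partner_of_track_eq {k l : Stroke} (hkl : k ≠ l) {t s : unitInterval}
    (ht : t ∈ Set.Ioo (0 : unitInterval) 1) (hs : s ∈ Set.Ioo (0 : unitInterval) 1)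
    (h : track k t = track l s) : partner k = l ∨ partner l = k :=
  (separated_of_ne k l hkl).resolve_left fun hsep =>
    hsep.along_ne (t := t) (s := s) ht hs h

/-- The direction of a stroke. -/
def direction (k : Stroke) : ℝ × ℝ := ((tgt k).1 - (src k).1, (tgt k).2 - (src k).2)

theorem shift_track (z : ℤ) (k : Stroke) (t : ℝ) :
    shift z (track k t) = shift z ((src k).1, (src k).2) + t • direction k := by
  refine Prod.ext ?_ ?_
  · simp only [shift, track, along, direction, Prod.fst_add, Prod.smul_fst, smul_eq_mul]
    ring
  · simp only [shift, track, along, direction, Prod.snd_add, Prod.smul_snd, smul_eq_mul]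

theorem direction_det_ne {k l : Stroke} (hkl : k ≠ l) (h : partner k = l ∨ partner l = k) :
    (direction k).1 * (direction l).2 - (direction k).2 * (direction l).1 ≠ 0 := by
  rcases h with rfl | rfl
  · have := partner_not_parallel k hkl.symm
    simp only [direction]
    exact_mod_cast this
  · have := partner_not_parallel l hkl
    simp only [direction]
    intro h
    apply this
    have h' : (((tgt (partner l)).1 : ℤ) - (src (partner l)).1) * ((tgt l).2 - (src l).2) -
      ((tgt (partner l)).2 - (src (partner l)).2) * ((tgt l).1 - (src l).1) = 0 := by
      exact_mod_cast h
    linear_combination -h'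

/-- Non-parallel lines meet once: Cramer's rule for the difference of the two equations. -/
theorem track_meet_once {k l : Stroke} (hkl : k ≠ l) (h : partner k = l ∨ partner l = k)
    {t s t' s' : ℝ} (h₁ : track k t = track l s) (h₂ : track k t' = track l s') : t = t' := by
  have hdet := direction_det_ne hkl h
  have a1 := congrArg Prod.fst h₁
  have a2 := congrArg Prod.snd h₁
  have b1 := congrArg Prod.fst h₂
  have b2 := congrArg Prod.snd h₂
  simp only [track, along] at a1 a2 b1 b2
  refine mul_right_cancel₀ hdet ?_
  simp only [direction]
  linear_combination ((tgt l).2 - (src l).2 : ℝ) * (a1 - b1) -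
    ((tgt l).1 - (src l).1 : ℝ) * (a2 - b2)

/-- Near a point of the segment, the arc has no other lift: two points of a stroke differ by at most
34 in abscissa, and 34 + 12d < 24d for `d ≥ 3`, so no nonzero period fits. -/
theorem mem_range_wheelArc_iff (hd : 3 ≤ d) (i : ZMod d) (k : Stroke) {t : ℝ}
    (ht : t ∈ Set.Icc (0 : ℝ) 1) {q : Plane} (hq : Proper (24 * d) q) (hy : |q.2| < 100)
    (hx : |q.1 - (shift i.val (track k t)).1| < 24 * d / 2) :
    wrap (24 * d) q ∈ Set.range (wheelArc d (i, k)) ↔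
      ∃ r ∈ Set.Icc (0 : ℝ) 1, q = shift i.val ((src k).1, (src k).2) + r • direction k := by
  constructor
  · rintro ⟨s, hs⟩
    refine ⟨s, s.2, ?_⟩
    rw [← shift_track]
    obtain ⟨h2, h1⟩ := wrap_eq circumference_pos hq (proper_shift_track d i.val k s.2) hs.symm
    obtain ⟨m, hm⟩ := h1 hy
    refine Prod.ext ?_ h2
    have hd' : (3 : ℝ) ≤ d := by exact_mod_cast hd
    obtain ⟨b1, b2⟩ := (track_bounds k ht).1
    obtain ⟨b3, b4⟩ := (track_bounds k s.2).1
    obtain ⟨b5, b6⟩ := abs_lt.1 hx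
    simp only [shift] at hm b5 b6
    have hm0 : m = 0 := by
      by_contra h0
      rcases lt_or_gt_of_ne h0 with h0 | h0
      · have : (m : ℝ) ≤ -1 := by exact_mod_cast (by omega : m ≤ -1)
        nlinarith
      · have : (1 : ℝ) ≤ m := by exact_mod_cast (by omega : 1 ≤ m)
        nlinarith
    rw [hm0, Int.cast_zero, zero_mul, add_zero] at hm
    exact hm
  · rintro ⟨r, hr, rfl⟩
    refine ⟨⟨r, hr⟩, ?_⟩
    rw [← shift_track]
    rfl

theorem wheelArc_transverse (hd : 3 ≤ d) (i : ZMod d) {k l : Stroke} (hkl : k ≠ l)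
    {t s : unitInterval} (ht : t ∈ Set.Ioo (0 : unitInterval) 1)
    (hs : s ∈ Set.Ioo (0 : unitInterval) 1) (h : track k t = track l s) :
    CrossTransversely (Set.range (wheelArc d (i, k))) (Set.range (wheelArc d (i, l)))
      (wheelArc d (i, k) t) := by
  have ht' : (t : ℝ) ∈ Set.Ioo (0 : ℝ) 1 := ht
  have hs' : (s : ℝ) ∈ Set.Ioo (0 : ℝ) 1 := hs
  have hp := proper_shift_track d i.val k t.2
  obtain ⟨χ, hχ, hsrc⟩ := exists_chart_wrap circumference_pos hp (abs_track_snd_lt k ht')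
  have hval : wheelArc d (i, k) t = χ (shift i.val (track k t)) := (hsrc _ hχ).1.symm
  rw [hval]
  refine crossTransversely_of_chart χ hχ ht' hs' (shift_track _ k t)
    (by rw [h]; exact shift_track _ l s)
    (direction_det_ne hkl (partner_of_track_eq hkl ht hs h)) ?_ ?_
  · intro q hq
    obtain ⟨h1, h2, h3, h4⟩ := hsrc q hq
    rw [h1]
    exact mem_range_wheelArc_iff hd i k t.2 h2 h3 h4
  · intro q hq
    obtain ⟨h1, h2, h3, h4⟩ := hsrc q hq
    rw [h1]
    rw [h] at h4
    exact mem_range_wheelArc_iff hd i l s.2 h2 h3 h4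

variable (d) in
/-- The arcs of all strokes of all wedges. -/
noncomputable def wheel (hd : 3 ≤ d) : ArcSystem (WheelVertex d) (ZMod d × Stroke) where
  point := wheelPoint d
  point_injective := wheelPoint_injective
  fst e := siteVertex d e.1 (ends e.2).1
  snd e := siteVertex d e.1 (ends e.2).2
  fst_ne_snd e := siteVertex_ends_ne hd e.1 e.2
  ends_injective := wheel_ends_injective hd
  arc := wheelArc d
  arc_continuous := continuous_wheelArc
  arc_injective := wheelArc_injective hd
  arc_zero e := wheelArc_zero e.1 e.2
  arc_one e := wheelArc_one e.1 e.2
  arc_avoids e _ ht v := wheelArc_ne_wheelPoint e ht v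
  transverse := by
    rintro ⟨i, k⟩ ⟨j, l⟩ hne p ⟨⟨t, ht, rfl⟩, ⟨s, hs, h⟩⟩
    obtain ⟨hij, h'⟩ := eq_of_wheelArc_eq ht hs h.symm
    obtain rfl : i = j := hij
    exact wheelArc_transverse hd i (fun hkl => hne (by rw [hkl])) ht hs h'
  no_triple := by
    rintro ⟨i₁, k₁⟩ ⟨i₂, k₂⟩ ⟨i₃, k₃⟩ h12 h23 h13
    rw [Set.eq_empty_iff_forall_notMem]
    rintro p ⟨⟨⟨t₁, ht₁, rfl⟩, ⟨t₂, ht₂, h₂⟩⟩, ⟨t₃, ht₃, h₃⟩⟩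
    obtain ⟨ha, ha'⟩ := eq_of_wheelArc_eq ht₁ ht₂ h₂.symm
    obtain ⟨hb, hb'⟩ := eq_of_wheelArc_eq ht₁ ht₃ h₃.symm
    obtain rfl : i₁ = i₂ := ha
    obtain rfl : i₁ = i₃ := hb
    have n12 : k₁ ≠ k₂ := fun h => h12 (by rw [h])
    have n23 : k₂ ≠ k₃ := fun h => h23 (by rw [h])
    have n13 : k₁ ≠ k₃ := fun h => h13 (by rw [h])
    exact no_partner_triangle k₁ k₂ k₃ n12 n23 n13 (partner_of_track_eq n12 ht₁ ht₂ ha')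
      (partner_of_track_eq n23 ht₂ ht₃ (ha'.symm.trans hb')) (partner_of_track_eq n13 ht₁ ht₃ hb')
  meet_once := by
    rintro ⟨i, k⟩ ⟨j, l⟩ hne p ⟨⟨t, ht, rfl⟩, ⟨s, hs, h⟩⟩ q ⟨⟨t', ht', rfl⟩, ⟨s', hs', h'⟩⟩
    obtain ⟨ha, ha'⟩ := eq_of_wheelArc_eq ht hs h.symm
    obtain ⟨-, hb'⟩ := eq_of_wheelArc_eq ht' hs' h'.symm
    obtain rfl : i = j := ha
    have hkl : k ≠ l := fun h => hne (by rw [h])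
    rw [Subtype.ext (track_meet_once hkl (partner_of_track_eq hkl ht hs ha') ha' hb')]
  -- A rim arc owns only itself, which is harmless because only pairs of distinct arcs cross.
  Owns e f := f = (e.1, partner e.2)
  owns := by
    rintro ⟨i, k⟩ ⟨j, l⟩ hne ⟨p, ⟨t, ht, rfl⟩, ⟨s, hs, h⟩⟩
    obtain ⟨ha, ha'⟩ := eq_of_wheelArc_eq ht hs h.symm
    obtain rfl : i = j := ha
    have hkl : k ≠ l := fun h => hne (by rw [h])
    exact (partner_of_track_eq hkl ht hs ha').imp (fun h => by rw [h]) fun h => by rw [h]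
  owns_unique _ _ _ h₁ h₂ := h₁.trans h₂.symm

end Wheel

/-! ### Selecting the hubs -/

/-- Kinds 6 to 9 are the hubs, and they occur only as first ends of spokes; hence removing a hub
affects only its own spokes. -/
theorem ends_lt_six (k : Stroke) :
    (∀ v ∈ (ends k).1.kind.getLeft?, (k.isLeft ∨ ∃ e, k = .inr (.inl e)) → v < 6) ∧
      ∀ v ∈ (ends k).2.kind.getLeft?, v < 6 := by
  revert k; decide +kernel

theorem hub_injective : Function.Injective hub := by decide

theorem hub_ne (f : Fin 4) (v : Fin 6) : hub f ≠ v.castLE (by omega) := by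
  revert f v; decide

section Hubs

variable (d r : ℕ)

/-- The wedge and the pentagon that contain the hub number `h`. -/
def hubPlace (h : Fin r) : ZMod d × Fin 4 := ((h / 4 : ℕ), Fin.ofNat 4 h)

/-- The vertices of `d` wedges with `r` hubs. -/
def vertexEmbedding : (ZMod d × Fin 6) ⊕ Fin 2 ⊕ Fin r → WheelVertex d
  | .inl (i, v) => .inl (i, v.castLE (by omega))
  | .inr (.inl p) => .inr p
  | .inr (.inr h) => .inl ((hubPlace d r h).1, hub (hubPlace d r h).2)

/-- The strokes of `d` wedges with `r` hubs. -/
def strokeEmbedding : (ZMod d × (Fin 10 ⊕ Fin 4 × Fin 5)) ⊕ Fin r × Fin 5 → ZMod d × Stroke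
  | .inl (i, .inl j) => (i, .inl j)
  | .inl (i, .inr e) => (i, .inr (.inl e))
  | .inr (h, j) => ((hubPlace d r h).1, .inr (.inr ((hubPlace d r h).2, j)))

variable {d r}

/-- Since `r ≤ 4 * d`, the quotient by 4 is less than `d` and survives the cast to `ZMod d`;
quotient and remainder determine the hub number. -/
theorem hubPlace_injective (hr : r ≤ 4 * d) : Function.Injective (hubPlace d r) := by
  intro h h' heq
  obtain ⟨h1, h2⟩ := Prod.mk.inj heq
  have h3 : (h : ℕ) % 4 = h' % 4 := congrArg Fin.val h2
  have h4 := (ZMod.natCast_eq_natCast_iff' _ _ d).1 h1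
  rw [Nat.mod_eq_of_lt (by omega), Nat.mod_eq_of_lt (by omega)] at h4
  apply Fin.ext
  omega

theorem vertexEmbedding_injective (hr : r ≤ 4 * d) : Function.Injective (vertexEmbedding d r) := by
  rintro (⟨i, v⟩ | p | h) (⟨j, w⟩ | q | h') heq
  all_goals simp only [vertexEmbedding, Sum.inl.injEq, Sum.inr.injEq, Prod.mk.injEq,
    reduceCtorEq] at heq
  · rw [heq.1, Fin.castLE_injective _ heq.2]
  · exact absurd heq.2.symm (hub_ne _ _)
  · rw [heq]
  · exact absurd heq.2 (hub_ne _ _)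
  · rw [hubPlace_injective hr (Prod.ext heq.1 (hub_injective heq.2))]

theorem strokeEmbedding_injective (hr : r ≤ 4 * d) : Function.Injective (strokeEmbedding d r) := by
  rintro (⟨i, j | e⟩ | ⟨h, j⟩) (⟨i', j' | e'⟩ | ⟨h', j'⟩) heq
  all_goals simp only [strokeEmbedding, Sum.inl.injEq, Sum.inr.injEq, Prod.mk.injEq,
    reduceCtorEq, and_false] at heq
  · rw [heq.1, heq.2]
  · rw [heq.1, heq.2]
  · rw [hubPlace_injective hr (Prod.ext heq.1 heq.2.1), heq.2.2]

theorem exists_vertexEmbedding_eq (i : ZMod d) (s : Site)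
    (hs : ∀ v ∈ s.kind.getLeft?, v < 6) : ∃ x, vertexEmbedding d r x = siteVertex d i s := by
  rcases s with ⟨v, o⟩ | p
  · have hv : v < 6 := hs v rfl
    exact ⟨.inl (i + o, ⟨v, hv⟩), rfl⟩
  · exact ⟨.inr (.inl p), rfl⟩

theorem exists_vertexEmbedding_eq_fst (e) : ∃ x, vertexEmbedding d r x =
    siteVertex d (strokeEmbedding d r e).1 (ends (strokeEmbedding d r e).2).1 := by
  rcases e with ⟨i, j | e⟩ | ⟨h, j⟩
  · exact exists_vertexEmbedding_eq _ _ fun v hv => (ends_lt_six _).1 v hv (.inl rfl)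
  · exact exists_vertexEmbedding_eq _ _ fun v hv => (ends_lt_six _).1 v hv (.inr ⟨e, rfl⟩)
  · refine ⟨.inr (.inr h), ?_⟩
    simp [vertexEmbedding, strokeEmbedding, ends, siteVertex]

theorem exists_vertexEmbedding_eq_snd (e) : ∃ x, vertexEmbedding d r x =
    siteVertex d (strokeEmbedding d r e).1 (ends (strokeEmbedding d r e).2).2 :=
  exists_vertexEmbedding_eq _ _ (ends_lt_six _).2

end Hubs

end GapPlanar

theorem mainTheorem8 (n : ℕ) (hn : 20 ≤ n) :
    ∃ G : SimpleGraph (Fin n),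
      GapPlanar.IsGapPlanarGraph G 1 ∧ G.edgeSet.ncard = 5 * n - 10 := by
  -- The bound `n ≥ 20` = 6 · 3 + 2 is exactly what gives three wedges; the remainder `r` is the
  -- number of hubs.
  obtain ⟨d, r, hd, hr, rfl⟩ : ∃ d r, 3 ≤ d ∧ r < 6 ∧ n = 6 * d + 2 + r :=
    ⟨(n - 2) / 6, (n - 2) % 6, by omega, by omega, by omega⟩
  have : NeZero d := ⟨by omega⟩
  have hr' : r ≤ 4 * d := by omega
  have e : Fin (6 * d + 2 + r) ≃ (ZMod d × Fin 6) ⊕ Fin 2 ⊕ Fin r := by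
    refine Fintype.equivOfCardEq ?_
    simp only [Fintype.card_sum, Fintype.card_prod, ZMod.card, Fintype.card_fin]
    ring
  let S := (GapPlanar.wheel d hd).restrict (GapPlanar.vertexEmbedding d r ∘ e)
    ((GapPlanar.vertexEmbedding_injective hr').comp e.injective) (GapPlanar.strokeEmbedding d r)
    (GapPlanar.strokeEmbedding_injective hr')
    (fun i => by
      obtain ⟨x, hx⟩ := GapPlanar.exists_vertexEmbedding_eq_fst (d := d) (r := r) i
      exact ⟨e.symm x, (congrArg _ (e.apply_symm_apply x)).trans hx⟩)
    (fun i => by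
      obtain ⟨x, hx⟩ := GapPlanar.exists_vertexEmbedding_eq_snd (d := d) (r := r) i
      exact ⟨e.symm x, (congrArg _ (e.apply_symm_apply x)).trans hx⟩)
  refine ⟨S.graph, S.isGapPlanarGraph, ?_⟩
  rw [S.ncard_edgeSet_graph, Nat.card_eq_fintype_card]
  simp only [Fintype.card_sum, Fintype.card_prod, ZMod.card, Fintype.card_fin]
  -- The count is d(10 + 20) + 5r = 5(6d + 2 + r) - 10.
  omega
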